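/- **Setting.** Let $M>0$, $D(r)=1-\frac{2M}{r}$, and consider the Schwarzschild metric $g=-D\,dv^2+2\,dv\,dr+r^2(d\theta^2+\sin^2\theta\,d\alpha^2)$ on $\mathbb R_v\times[2M,\infty)_r\times\mathbb S^2$. Spherically symmetric functions are regarded as functions of $(v,r)$. Put $T=\partial_v$, $L=\frac D2\partial_r+\partial_v$, $\underline L=-\frac D2\partial_r$ in $(v,r)$-coordinates. Let $2M<r_{\mathcal H}<4M<R$, $v_0\in\mathbb R$, and let $\Sigma_0=\{v=v_{\Sigma_0}(r)\}$, $v_{\Sigma_0}(r)=v_0+\int_{2M}^r h$, where $h\ge 0$ is piecewise smooth with $h=0$ for $2M\le r\le r_{\mathcal H}$, $0<h<\frac 2D$ for $r_{\mathcal H}<r<R$, and $h=\frac2D$ for $r\ge R$. Thus $N_0^{\mathcal H}=\Sigma_0\cap\{r\le r_{\mathcal H}\}$ is ingoing null, $\Sigma_0^*=\Sigma_0\cap\{r_{\mathcal H}\le r\le R\}$ is spacelike in its interior, and $N_0^{\mathcal I}=\Sigma_0\cap\{r\ge R\}$ is outgoing null, of the form $\{u=u_0\}$ with $du=dv-2D^{-1}dr$.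 On $N_0^{\mathcal I}$, $\partial_r$ denotes the derivative in $(u,r)$-coordinates, that is, along $N_0^{\mathcal I}$. Write $$J^+(\Sigma_0)=\{(v,r): r\ge 2M,\ v\ge v_{\Sigma_0}(r)\}.$$ Let $\phi$ be a spherically symmetric solution of $\Box_g\phi=0$, smooth on $J^+(\Sigma_0)$ up to and including $\Sigma_0$ and the horizon. A *time integral* of $\phi$ is a spherically symmetric function $\phi^{(1)}$ on $J^+(\Sigma_0)$ (continuous, and $C^2$ for $r>2M$) with $$T\phi^{(1)}=\phi,\qquad \Box_g\phi^{(1)}=0,\qquad \lim_{v\to\infty}\phi^{(1)}(u_0,v)=0,\qquad \lim_{u\to\infty}\underline L\phi^{(1)}(u,v_0)=0 .$$ For a function $\psi$ as above define, whenever the limits along $N_0^{\mathcal I}$ exist, $$I_0^{\frac{\log r}{r^3}}[\psi]=\lim_{r\to\infty}\tfrac{r^3}{\log r}\partial_r(r\psi),\qquad I_0^{\log}[\psi]=\lim_{r\to\infty}\tfrac{r^2}{\log r}\partial_r(r\psi),$$ $$I_0'[\psi]=\lim_{r\to\infty}r^2\Big(\partial_r(r\psi)-I_0^{\log}[\psi]\tfrac{\log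 r+\log 2}{r^2}\Big),\qquad I_0''[\psi]=\lim_{r\to\infty}r^2\Big(\partial_r(r\psi)-I_0^{\log}[\psi]\tfrac{\log r-\log 2}{r^2}\Big).$$ Finally, with $n_{\Sigma_0}$ and $d\mu_{\Sigma_0}$ the future unit normal and the induced volume form of $\Sigma_0^*$, define $C_0[\phi]$ by $$C_0[\phi]=2\int_{N_0^{\mathcal H}}r\underline L(r\phi)\,du+\frac1{4\pi}\int_{\Sigma_0^*}n_{\Sigma_0}(\phi)\,d\mu_{\Sigma_0}+r^2\phi|_{\Sigma_0\cap\{r=r_{\mathcal H}\}}+r^2\phi|_{\Sigma_0\cap\{r=R\}}+2\int_{N_0^{\mathcal I}}rL(r\phi)\,dv .$$ **Proposition.** Let $R>0$ and $\beta\in(0,1)$. There is a constant $C=C(R,\beta)>0$ such that the following holds for all $M$, $\Sigma_0$ (with this $R$), and $\phi$ as above. Suppose that $I:=I_0^{\frac{\log r}{r^3}}[\phi]$ exists and that for some constants $J$, $P$ and all $r\ge R$, on $N_0^{\mathcal I}$, $$\Big|\partial_r(r\phi)-I\,\frac{\log r}{r^3}-\frac{J}{r^3}\Big|\le P\,r^{-3-\beta}.$$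 Put $K=C\,(P+|I|+|J|+|C_0[\phi]|)$. Then the time integral $\phi^{(1)}$ of $\phi$ satisfies on $N_0^{\mathcal I}$, for all $r\ge R$, $$\Big|\partial_r(r\phi^{(1)})+I\,\frac{\log r}{r^2}+\frac{J+\frac12 I-MC_0[\phi]}{r^2}\Big|\le K\,r^{-2-\beta},$$ $$\Big|\partial_r^2(r\phi^{(1)})-2I\,\frac{\log r}{r^3}-\frac{2J-2MC_0[\phi]}{r^3}\Big|\le K\,r^{-3-\beta}.$$ In particular, $I_0^{\log}[\phi^{(1)}]$, $I_0'[\phi^{(1)}]$ and $I_0''[\phi^{(1)}]$ exist, and $$I_0^{\log}[\phi^{(1)}]=-I_0^{\frac{\log r}{r^3}}[\phi],$$ $$I_0'[\phi^{(1)}]+\log 2\; I_0^{\log}[\phi^{(1)}]=MC_0[\phi]-J-\tfrac12 I_0^{\frac{\log r}{r^3}}[\phi],$$ $$I_0''[\phi^{(1)}]-\log 2\; I_0^{\log}[\phi^{(1)}]=MC_0[\phi]-J-\tfrac12 I_0^{\frac{\log r}{r^3}}[\phi].$$ -/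

import Mathlib

open scoped ContDiff
open Set Filter Topology

namespace Schwarzschild

/-- The metric function `D(r) = 1 - 2M/r`. -/
noncomputable def D (M r : ℝ) : ℝ := 1 - 2 * M / r

/-- The components of the Schwarzschild metric
`-D dv² + 2 dv dr + r² (dθ² + sin² θ dα²)` in the coordinates `(x 0, x 1, x 2, x 3) = (v, r, θ, α)`. -/
noncomputable def metric (M : ℝ) (x : Fin 4 → ℝ) : Matrix (Fin 4) (Fin 4) ℝ :=
  !![-(D M (x 1)), 1, 0, 0;
     1, 0, 0, 0;
     0, 0, (x 1) ^ 2, 0;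
     0, 0, 0, (x 1) ^ 2 * Real.sin (x 2) ^ 2]

/-- The `i`-th partial derivative of a function on coordinate space. -/
noncomputable def pd (i : Fin 4) (f : (Fin 4 → ℝ) → ℝ) (x : Fin 4 → ℝ) : ℝ :=
  deriv (fun s => f (Function.update x i s)) (x i)

/-- The Laplace–Beltrami (wave) operator
`|det g|^{-1/2} ∑ ∂_i (|det g|^{1/2} g^{ij} ∂_j f)` of a metric given by its components `g`. -/
noncomputable def box (g : (Fin 4 → ℝ) → Matrix (Fin 4) (Fin 4) ℝ) (f : (Fin 4 → ℝ) → ℝ)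
    (x : Fin 4 → ℝ) : ℝ :=
  (√|(g x).det|)⁻¹ *
    ∑ i, pd i (fun y => √|(g y).det| * ∑ j, (g y)⁻¹ i j * pd j f y) x

/-- A spherically symmetric function, given as a function of `(v, r)`,
regarded as a function of `(v, r, θ, α)`. -/
def lift (φ : ℝ × ℝ → ℝ) (x : Fin 4 → ℝ) : ℝ := φ (x 0, x 1)

/-- `h` is smooth on each piece, up to the ends of the piece, of a finite partition of `[a, b]`. -/
def PiecewiseSmooth (h : ℝ → ℝ) (a b : ℝ) : Prop :=
  ∃ (n : ℕ) (t : ℕ → ℝ), t 0 = a ∧ t n = b ∧ ∀ i < n, t i < t (i + 1) ∧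
    ∃ g : ℝ → ℝ, ContDiffOn ℝ ∞ g (Icc (t i) (t (i + 1))) ∧ EqOn h g (Ioo (t i) (t (i + 1)))

/-- A spherically symmetric hypersurface `Σ₀ = {v = v₀ + ∫_{2M}^r h}` which is ingoing null for
`2M ≤ r ≤ r_H`, strictly spacelike for `r_H < r < R`, and outgoing null for `r ≥ R`. -/
structure Slice (M R : ℝ) where
  rH : ℝ
  v₀ : ℝ
  h : ℝ → ℝ
  two_mul_lt_rH : 2 * M < rH
  rH_lt : rH < 4 * M
  lt_R : 4 * M < R
  h_horizon : ∀ r ∈ Icc (2 * M) rH, h r = 0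
  h_spacelike : ∀ r ∈ Ioo rH R, 0 < h r ∧ h r < 2 / D M r
  h_infinity : ∀ r, R ≤ r → h r = 2 / D M r
  h_smooth : PiecewiseSmooth h rH R

namespace Slice

variable {M R : ℝ}

/-- The height function `v_{Σ₀}(r)`. -/
noncomputable def height (S : Slice M R) (r : ℝ) : ℝ := S.v₀ + ∫ s in (2 * M)..r, S.h s

/-- The point of `Σ₀` of area radius `r`, in `(v, r)`-coordinates. -/
noncomputable def pt (S : Slice M R) (r : ℝ) : ℝ × ℝ := (S.height r, r)

/-- The causal future `J⁺(Σ₀)`, in `(v, r)`-coordinates, including `Σ₀` and the future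
event horizon `r = 2M`. -/
def future (S : Slice M R) : Set (ℝ × ℝ) := {p | 2 * M ≤ p.2 ∧ S.height p.2 ≤ p.1}

/-- `∂_v` in `(v, r)`-coordinates, that is, the Killing field `T` (one-sided on the boundary
of `J⁺(Σ₀)`). -/
noncomputable def dv (S : Slice M R) (f : ℝ × ℝ → ℝ) (p : ℝ × ℝ) : ℝ :=
  fderivWithin ℝ f S.future p (1, 0)

/-- `∂_r` in `(v, r)`-coordinates (one-sided on the boundary of `J⁺(Σ₀)`). -/
noncomputable def dr (S : Slice M R) (f : ℝ × ℝ → ℝ) (p : ℝ × ℝ) : ℝ :=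
  fderivWithin ℝ f S.future p (0, 1)

/-- The outgoing null vector field `L = (D/2) ∂_r + ∂_v`. -/
noncomputable def L (S : Slice M R) (f : ℝ × ℝ → ℝ) (p : ℝ × ℝ) : ℝ :=
  D M p.2 / 2 * S.dr f p + S.dv f p

/-- The ingoing null vector field `L̲ = -(D/2) ∂_r`. -/
noncomputable def Lbar (S : Slice M R) (f : ℝ × ℝ → ℝ) (p : ℝ × ℝ) : ℝ :=
  -(D M p.2 / 2) * S.dr f p

/-- The future unit normal of the spacelike part of `Σ₀`, applied to `f` at radius `r`. -/
noncomputable def normal (S : Slice M R) (f : ℝ × ℝ → ℝ) (r : ℝ) : ℝ :=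
  (S.h r * S.dv f (S.pt r) - (1 - D M r * S.h r) * S.dr f (S.pt r)) /
    √(S.h r * (2 - D M r * S.h r))

/-- The density of the induced volume form of the spacelike part of `Σ₀` with respect
to `dr dω`. -/
noncomputable def volDensity (S : Slice M R) (r : ℝ) : ℝ :=
  r ^ 2 * √(S.h r * (2 - D M r * S.h r))

/-- `□_g f = 0` in the interior of `J⁺(Σ₀)`. -/
def SolvesWave (S : Slice M R) (f : ℝ × ℝ → ℝ) : Prop :=
  ∀ v r θ α : ℝ, 2 * M < r → S.height r < v → θ ∈ Ioo 0 Real.pi →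
    box (metric M) (lift f) ![v, r, θ, α] = 0

/-- `φ` is a spherically symmetric solution of the wave equation on `J⁺(Σ₀)`, smooth up to and
including `Σ₀` and the event horizon. -/
structure IsSmoothSolution (S : Slice M R) (φ : ℝ × ℝ → ℝ) : Prop where
  smooth : ContDiffOn ℝ ∞ φ S.future
  wave : S.SolvesWave φ

/-- `φ₁` is the time integral of `φ`. Away from the event horizon only two derivatives are
required; at the horizon `φ₁` is only assumed to be continuous, and the condition
`lim_{u → ∞} L̲ φ₁ (u, v₀) = 0` is imposed. -/
structure IsTimeIntegral (S : Slice M R) (φ φ₁ : ℝ × ℝ → ℝ) : Prop where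
  cont : ContinuousOn φ₁ S.future
  regular : ContDiffOn ℝ 2 φ₁ (S.future ∩ {p | 2 * M < p.2})
  time_deriv : ∀ p ∈ S.future, 2 * M < p.2 → S.dv φ₁ p = φ p
  wave : S.SolvesWave φ₁
  lim_infinity : Tendsto (fun r => φ₁ (S.pt r)) atTop (𝓝 0)
  lim_horizon : Tendsto (fun r => S.Lbar φ₁ (S.v₀, r)) (𝓝[>] (2 * M)) (𝓝 0)

/-- The function `r ↦ ∂_r (r φ)` along the outgoing null part `r ≥ R` of `Σ₀`, with `∂_r` taken
in `(u, r)`-coordinates, hence tangent to it. -/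
noncomputable def drad (S : Slice M R) (φ : ℝ × ℝ → ℝ) (r : ℝ) : ℝ :=
  derivWithin (fun s => s * φ (S.pt s)) (Ici R) r

/-- The function `r ↦ ∂_r² (r φ)` along the outgoing null part `r ≥ R` of `Σ₀`. -/
noncomputable def drad2 (S : Slice M R) (φ : ℝ × ℝ → ℝ) (r : ℝ) : ℝ :=
  derivWithin (S.drad φ) (Ici R) r

/-- `c` is the modified Newman–Penrose constant of `φ` with weight `f`, the limit of
`f(r) ∂_r (r φ)` at future null infinity along `Σ₀`. -/
def IsNPConstant (S : Slice M R) (f : ℝ → ℝ) (φ : ℝ × ℝ → ℝ) (c : ℝ) : Prop :=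
  Tendsto (fun r => f r * S.drad φ r) atTop (𝓝 c)

/-- `c = lim r² (∂_r (r φ) - a (log r + s) / r²)` at future null infinity along `Σ₀`. -/
def IsPrimedConstant (S : Slice M R) (φ : ℝ × ℝ → ℝ) (a s c : ℝ) : Prop :=
  Tendsto (fun r => r ^ 2 * (S.drad φ r - a * (Real.log r + s) / r ^ 2)) atTop (𝓝 c)

/-- The function `r φ`. -/
def rmul (φ : ℝ × ℝ → ℝ) (p : ℝ × ℝ) : ℝ := p.2 * φ p

/-- The constant `C₀'[φ]`. The area `4π` of the unit sphere is divided out. On the ingoing null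
part `|du| = 2 D⁻¹ dr`. -/
noncomputable def C₀' (S : Slice M R) (φ : ℝ × ℝ → ℝ) : ℝ :=
  2 * (∫ r in (2 * M)..S.rH, r * S.Lbar (rmul φ) (S.pt r) * (2 / D M r))
    + (∫ r in S.rH..R, S.normal φ r * S.volDensity r)
    + (S.rH ^ 2 * φ (S.pt S.rH) + R ^ 2 * φ (S.pt R))

/-- The constant `C₀[φ]`, which adds to `C₀'[φ]` the integral over the outgoing null part of `Σ₀`,
where `dv = 2 D⁻¹ dr`. -/
noncomputable def C₀ (S : Slice M R) (φ : ℝ × ℝ → ℝ) : ℝ :=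
  S.C₀' φ + 2 * ∫ r in Ioi R, r * S.L (rmul φ) (S.pt r) * (2 / D M r)

end Slice

end Schwarzschild

/-!
Since `T φ₁ = φ`, the wave equation of `φ₁` becomes, along the slice, a first-order equation for
the flux `D r² ∂_r φ₁` whose source involves only `φ`. The flux vanishes at the horizon, so
integrating the source over the three pieces of the slice expresses it through `φ`; along the
outgoing null piece, with `∂_r` tangent to the slice, it converges to `C₀[φ]`, and the decay of
`∂_r (r φ)` gives the rate `r ^ (-β)`. On that piece

  `∂_r² (r φ₁) = 2 D⁻¹ ∂_r (r φ) - 2 M D⁻² r⁻³ (D r² ∂_r φ₁)`,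

where `M C₀[φ]` comes from the last term. This is the second expansion, and integrating it from
`r = ∞`, where `∂_r (r φ₁)` vanishes, yields the first one.
-/

namespace Schwarzschild

open MeasureTheory

section Decay

theorem norm_sub_le_rpow_of_norm_deriv_le {E : Type*} [NormedAddCommGroup E] [NormedSpace ℝ E]
    {F F' : ℝ → E} {l : E} {R K a r : ℝ} (hR : 0 < R) (ha : 0 < a)
    (hF : ∀ s, R ≤ s → HasDerivWithinAt F (F' s) (Ici R) s)
    (hF' : ∀ s, R ≤ s → ‖F' s‖ ≤ K * s ^ (-a - 1)) (hlim : Tendsto F atTop (𝓝 l)) (hr : R ≤ r) :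
    ‖F r - l‖ ≤ K / a * r ^ (-a) := by
  have hB (s : ℝ) (hs : r ≤ s) :
      HasDerivAt (fun x : ℝ => K / a * (r ^ (-a) - x ^ (-a))) (K * s ^ (-a - 1)) s :=
    (((Real.hasDerivAt_rpow_const (Or.inl (hR.trans_le (hr.trans hs)).ne')).const_sub
      (r ^ (-a))).const_mul (K / a)).congr_deriv (by field_simp)
  have hdiff (s : ℝ) (hs : r ≤ s) : ‖F s - F r‖ ≤ K / a * (r ^ (-a) - s ^ (-a)) := by
    refine image_norm_le_of_norm_deriv_right_le_deriv_boundary' (f := fun x => F x - F r)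
      (fun x hx => ?_) (fun x hx => ?_) (by simp)
      (fun x hx => (hB x hx.1).continuousAt.continuousWithinAt)
      (fun x hx => (hB x hx.1).hasDerivWithinAt) (fun x hx => hF' x (hr.trans hx.1))
      (right_mem_Icc.2 hs)
    · exact ((hF x (hr.trans hx.1)).continuousWithinAt.mono
        (Icc_subset_Ici_self.trans (Ici_subset_Ici.2 hr))).sub continuousWithinAt_const
    · exact ((hF x (hr.trans hx.1)).mono (Ici_subset_Ici.2 (hr.trans hx.1))).sub_const (F r)
  have hbound : Tendsto (fun s : ℝ => K / a * (r ^ (-a) - s ^ (-a))) atTop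
      (𝓝 (K / a * r ^ (-a))) := by
    simpa using ((tendsto_rpow_neg_atTop ha).const_sub (r ^ (-a))).const_mul (K / a)
  rw [norm_sub_rev]
  exact le_of_tendsto_of_tendsto (hlim.sub_const (F r)).norm hbound
    ((eventually_ge_atTop r).mono hdiff)

theorem exists_abs_log_add_one_le_rpow {R a : ℝ} (hR : 0 < R) (ha : 0 < a) :
    ∃ Λ : ℝ, 0 < Λ ∧ ∀ r, R ≤ r → |Real.log r| + 1 ≤ Λ * r ^ a := by
  refine ⟨1 / a + (|Real.log R| + 1) / R ^ a, by positivity, fun r hr => ?_⟩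
  have hr0 := hR.trans_le hr
  have hupper : Real.log r ≤ r ^ a / a := Real.log_le_rpow_div hr0.le ha
  have hlower : Real.log R ≤ Real.log r := Real.log_le_log hR hr
  have hratio : 1 ≤ r ^ a / R ^ a := by
    rw [one_le_div (by positivity)]
    exact Real.rpow_le_rpow hR.le hr ha.le
  have habs : |Real.log r| ≤ r ^ a / a + |Real.log R| := by
    have hpos : 0 < r ^ a / a := by positivity
    rw [abs_le]
    constructor <;> linarith [neg_abs_le (Real.log R), abs_nonneg (Real.log R)]
  calc |Real.log r| + 1 ≤ r ^ a / a + (|Real.log R| + 1) * 1 := by linarith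
    _ ≤ r ^ a / a + (|Real.log R| + 1) * (r ^ a / R ^ a) := by gcongr
    _ = _ := by ring

theorem rpow_neg_ofNat_sub {r : ℝ} (hr : 0 < r) (β : ℝ) (n : ℕ) [n.AtLeastTwo] :
    r ^ (-OfNat.ofNat n - β : ℝ) = r ^ (-β) / r ^ n := by
  rw [neg_sub_comm, ← Real.rpow_sub_natCast hr.ne']
  rfl

theorem rpow_one_sub {r : ℝ} (hr : 0 < r) (β : ℝ) : r ^ (1 - β) = r * r ^ (-β) := by
  rw [sub_eq_add_neg, Real.rpow_add hr, Real.rpow_one]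

theorem abs_mul_add_le (a b x : ℝ) : |a * x + b| ≤ (|a| + |b|) * (|x| + 1) := by
  calc |a * x + b| ≤ |a| * |x| + |b| := by rw [← abs_mul]; exact abs_add_le _ _
    _ ≤ _ := by nlinarith [mul_nonneg (abs_nonneg b) (abs_nonneg x), abs_nonneg a]

variable {R β Λ I J P r : ℝ}

theorem abs_le_rpow_of_log_expansion {q : ℝ} (hR : 0 < R) (hr : R ≤ r)
    (hΛ : |Real.log r| + 1 ≤ Λ * r ^ (1 - β))
    (hq : |q - I * (Real.log r / r ^ 3) - J / r ^ 3| ≤ P * r ^ (-3 - β)) :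
    |q| ≤ (R⁻¹ + Λ) * (P + |I| + |J|) * r ^ (-2 - β) := by
  have hr0 := hR.trans_le hr
  rw [rpow_neg_ofNat_sub hr0] at hq ⊢
  rw [rpow_one_sub hr0] at hΛ
  set X := r ^ (-β)
  have hX : 0 < X := Real.rpow_pos_of_pos hr0 _
  have hP : 0 ≤ P :=
    nonneg_of_mul_nonneg_left ((abs_nonneg _).trans hq) (div_pos hX (pow_pos hr0 3))
  have hΛ0 : 0 ≤ Λ :=
    nonneg_of_mul_nonneg_left (le_trans (by positivity) hΛ) (mul_pos hr0 hX)
  have hmain : |(I * Real.log r + J) / r ^ 3| ≤ Λ * (|I| + |J|) * (X / r ^ 2) := by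
    rw [abs_div, abs_of_pos (pow_pos hr0 3)]
    calc |I * Real.log r + J| / r ^ 3
        ≤ (|I| + |J|) * (|Real.log r| + 1) / r ^ 3 := by
          gcongr; exact abs_mul_add_le _ _ _
      _ ≤ (|I| + |J|) * (Λ * (r * X)) / r ^ 3 := by gcongr
      _ = _ := by field_simp
  have hrest : P * (X / r ^ 3) ≤ R⁻¹ * P * (X / r ^ 2) := by
    calc P * (X / r ^ 3) = r⁻¹ * P * (X / r ^ 2) := by field_simp
      _ ≤ _ := by gcongr
  calc |q| = |(q - I * (Real.log r / r ^ 3) - J / r ^ 3) + (I * Real.log r + J) / r ^ 3| := by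
        congr 1; ring
    _ ≤ P * (X / r ^ 3) + Λ * (|I| + |J|) * (X / r ^ 2) := (abs_add_le _ _).trans (by gcongr)
    _ ≤ (R⁻¹ * P + Λ * (|I| + |J|)) * (X / r ^ 2) := by linarith
    _ ≤ _ := by
      gcongr
      nlinarith [mul_nonneg hΛ0 hP, mul_nonneg (inv_nonneg.2 hR.le) (abs_nonneg I),
        mul_nonneg (inv_nonneg.2 hR.le) (abs_nonneg J)]

theorem abs_log_expansion_le_of_deriv {ψ ψ' : ℝ → ℝ} {A K : ℝ} (hR : 0 < R) (hβ : 0 < β)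
    (hψ : ∀ s, R ≤ s → HasDerivWithinAt ψ (ψ' s) (Ici R) s)
    (hψ' : ∀ s, R ≤ s →
      |ψ' s - 2 * I * (Real.log s / s ^ 3) - 2 * A / s ^ 3| ≤ K * s ^ (-3 - β))
    (hlim : Tendsto ψ atTop (𝓝 0)) (hr : R ≤ r) :
    |ψ r + I * (Real.log r / r ^ 2) + (A + 1 / 2 * I) / r ^ 2| ≤ K * r ^ (-2 - β) := by
  have hderiv (s : ℝ) (hs : R ≤ s) : HasDerivWithinAt
      (fun s => ψ s + (I * Real.log s + (A + 1 / 2 * I)) / s ^ 2)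
      (ψ' s - 2 * I * (Real.log s / s ^ 3) - 2 * A / s ^ 3) (Ici R) s := by
    have hs0 := (hR.trans_le hs).ne'
    refine ((hψ s hs).add ((((Real.hasDerivAt_log hs0).const_mul I).add_const _).div
      (hasDerivAt_pow 2 s) (pow_ne_zero 2 hs0)).hasDerivWithinAt).congr_deriv ?_
    field_simp
    ring
  have hzero : Tendsto (fun s => ψ s + (I * Real.log s + (A + 1 / 2 * I)) / s ^ 2) atTop
      (𝓝 0) := by
    have hlog : Tendsto (fun s : ℝ => Real.log s / s ^ 2) atTop (𝓝 0) :=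
      by simpa using (isLittleO_log_rpow_atTop two_pos).tendsto_div_nhds_zero
    have hconst : Tendsto (fun s : ℝ => (A + 1 / 2 * I) / s ^ 2) atTop (𝓝 0) :=
      tendsto_const_nhds.div_atTop (tendsto_pow_atTop two_ne_zero)
    simpa [add_div, mul_div_assoc] using hlim.add ((hlog.const_mul I).add hconst)
  have hK : 0 ≤ K := nonneg_of_mul_nonneg_left ((abs_nonneg _).trans (hψ' R le_rfl))
    (Real.rpow_pos_of_pos hR _)
  have key := norm_sub_le_rpow_of_norm_deriv_le (a := 2 + β) hR (by linarith) hderiv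
    (fun s hs => (hψ' s hs).trans_eq (by ring_nf)) hzero hr
  calc |ψ r + I * (Real.log r / r ^ 2) + (A + 1 / 2 * I) / r ^ 2|
      = ‖ψ r + (I * Real.log r + (A + 1 / 2 * I)) / r ^ 2 - 0‖ := by
        rw [sub_zero, Real.norm_eq_abs]; congr 1; ring
    _ ≤ K / (2 + β) * r ^ (-(2 + β)) := key
    _ ≤ K * r ^ (-2 - β) := by
      rw [neg_add']
      gcongr
      · exact Real.rpow_nonneg (hR.trans_le hr).le _
      · exact div_le_self hK (by linarith)

theorem tendsto_of_log_expansion {g : ℝ → ℝ} {A K : ℝ} (hβ : 0 < β)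
    (hg : ∀ r, R ≤ r → |g r + I * (Real.log r / r ^ 2) + A / r ^ 2| ≤ K * r ^ (-2 - β)) :
    Tendsto (fun r => r ^ 2 * g r + I * Real.log r) atTop (𝓝 (-A)) := by
  rw [tendsto_iff_norm_sub_tendsto_zero]
  have hdecay : Tendsto (fun r : ℝ => K * r ^ (-β)) atTop (𝓝 0) := by
    simpa using (tendsto_rpow_neg_atTop hβ).const_mul K
  refine squeeze_zero' (Eventually.of_forall fun _ => norm_nonneg _) ?_ hdecay
  filter_upwards [eventually_ge_atTop R, eventually_gt_atTop 0] with r hr hr0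
  calc ‖r ^ 2 * g r + I * Real.log r - -A‖
      = r ^ 2 * |g r + I * (Real.log r / r ^ 2) + A / r ^ 2| := by
        rw [← abs_of_pos (pow_pos hr0 2), ← abs_mul, abs_of_pos (pow_pos hr0 2),
          Real.norm_eq_abs]
        congr 1
        field_simp
        ring
    _ ≤ r ^ 2 * (K * r ^ (-2 - β)) := by gcongr; exact hg r hr
    _ = K * r ^ (-β) := by rw [rpow_neg_ofNat_sub hr0]; field_simp; ring

end Decay

section Mass

variable {M R r : ℝ}

theorem D_pos (hM : 0 ≤ M) (hr : 2 * M < r) : 0 < D M r := by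
  rw [D, sub_pos, div_lt_one (by linarith)]
  exact hr

theorem hasDerivAt_D (hr : r ≠ 0) : HasDerivAt (D M) (2 * M / r ^ 2) r :=
  (((hasDerivAt_const r (2 * M)).div (hasDerivAt_id r) hr).const_sub 1).congr_deriv
    (by simp [neg_div])

theorem continuousOn_D (hM : 0 ≤ M) : ContinuousOn (D M) (Ioi (2 * M)) := fun r hr =>
  have hr0 : 0 < r := by linarith [mem_Ioi.1 hr]
  (hasDerivAt_D hr0.ne').continuousAt.continuousWithinAt

theorem continuousOn_two_div_D (hM : 0 ≤ M) : ContinuousOn (fun r => 2 / D M r) (Ioi (2 * M)) :=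
  continuousOn_const.div (continuousOn_D hM) fun _ hr => (D_pos hM hr).ne'

theorem inv_D_bounds (hM : 0 ≤ M) (hR : 4 * M < R) (hr : R ≤ r) :
    1 ≤ (D M r)⁻¹ ∧ (D M r)⁻¹ ≤ 2 ∧ (D M r)⁻¹ ≤ 1 + R / r := by
  have hr0 : 0 < r := by linarith
  have hD : 0 < D M r := D_pos hM (by linarith)
  have hhalf : 1 / 2 ≤ D M r := by
    rw [D, le_sub_comm, div_le_iff₀ hr0]
    linarith
  have hinv : (D M r)⁻¹ ≤ 2 := by
    rw [inv_le_comm₀ hD two_pos]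
    linarith
  refine ⟨(one_le_inv₀ hD).2 (sub_le_self 1 (by positivity)), hinv, ?_⟩
  calc (D M r)⁻¹ = 1 + 2 * M / r * (D M r)⁻¹ := by
        have hsum : D M r + 2 * M / r = 1 := sub_add_cancel _ _
        field_simp at hsum ⊢
        linarith
    _ ≤ 1 + 2 * M / r * 2 := by gcongr
    _ = 1 + 4 * M / r := by ring
    _ ≤ 1 + R / r := by gcongr

variable {β Λ I J P q : ℝ}

theorem abs_inv_D_mul_sub_le (hM : 0 ≤ M) (hR : 4 * M < R) (hr : R ≤ r)
    (hΛ : |Real.log r| + 1 ≤ Λ * r ^ (1 - β))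
    (hq : |q - I * (Real.log r / r ^ 3) - J / r ^ 3| ≤ P * r ^ (-3 - β)) :
    |(D M r)⁻¹ * q - I * (Real.log r / r ^ 3) - J / r ^ 3| ≤
      (2 * P + R * Λ * (|I| + |J|)) * r ^ (-3 - β) := by
  have hR0 : 0 < R := by linarith
  have hr0 : 0 < r := hR0.trans_le hr
  obtain ⟨hd_ge, hd_two, hd_one⟩ := inv_D_bounds hM hR hr
  rw [rpow_neg_ofNat_sub hr0] at hq ⊢
  rw [rpow_one_sub hr0] at hΛ
  set X := r ^ (-β)
  set d := (D M r)⁻¹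
  have herror : |d * (q - I * (Real.log r / r ^ 3) - J / r ^ 3)| ≤ 2 * (P * (X / r ^ 3)) := by
    rw [abs_mul, abs_of_nonneg (by linarith)]
    gcongr
  have hmain : |(d - 1) * ((I * Real.log r + J) / r ^ 3)| ≤
      R / r * ((|I| + |J|) * (Λ * (r * X)) / r ^ 3) := by
    rw [abs_mul, abs_div, abs_of_nonneg (by linarith), abs_of_pos (pow_pos hr0 3)]
    gcongr
    · linarith
    · exact (abs_mul_add_le _ _ _).trans (by gcongr)
  calc |d * q - I * (Real.log r / r ^ 3) - J / r ^ 3|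
      = |d * (q - I * (Real.log r / r ^ 3) - J / r ^ 3)
          + (d - 1) * ((I * Real.log r + J) / r ^ 3)| := by congr 1; ring
    _ ≤ 2 * (P * (X / r ^ 3)) + R / r * ((|I| + |J|) * (Λ * (r * X)) / r ^ 3) :=
      (abs_add_le _ _).trans (add_le_add herror hmain)
    _ = _ := by field_simp; ring

theorem abs_inv_D_sq_mul_sub_le {G c B : ℝ} (hM : 0 ≤ M) (hR : 4 * M < R) (hr : R ≤ r)
    (hΛ : |Real.log r| + 1 ≤ Λ * r ^ (1 - β)) (hG : |G - c| ≤ B * r ^ (-β)) :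
    |2 * M * (D M r)⁻¹ ^ 2 * G - 2 * M * c| ≤ (2 * R * B + 2 * R ^ 2 * Λ * |c|) * r ^ (-β) := by
  have hR0 : 0 < R := by linarith
  have hr0 : 0 < r := hR0.trans_le hr
  obtain ⟨hd_ge, hd_two, hd_one⟩ := inv_D_bounds hM hR hr
  rw [rpow_one_sub hr0] at hΛ
  set X := r ^ (-β)
  set d := (D M r)⁻¹
  have hX : 1 / r ≤ Λ * X := by
    rw [div_le_iff₀ hr0]
    linarith [abs_nonneg (Real.log r)]
  have hM2 : 2 * M ≤ R / 2 := by linarith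
  have herror : |2 * M * d ^ 2 * (G - c)| ≤ R / 2 * 2 ^ 2 * (B * X) := by
    rw [abs_mul, abs_of_nonneg (by positivity)]
    gcongr
  have hmain : |2 * M * ((d - 1) * (d + 1)) * c| ≤ R / 2 * (R / r * 3) * |c| := by
    rw [abs_mul, abs_of_nonneg (mul_nonneg (by linarith)
      (mul_nonneg (by linarith) (by linarith)))]
    gcongr <;> linarith
  calc |2 * M * d ^ 2 * G - 2 * M * c|
      = |2 * M * d ^ 2 * (G - c) + 2 * M * ((d - 1) * (d + 1)) * c| := by congr 1; ring
    _ ≤ R / 2 * 2 ^ 2 * (B * X) + R / 2 * (R / r * 3) * |c| :=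
      (abs_add_le _ _).trans (add_le_add herror hmain)
    _ = 2 * R * B * X + 3 / 2 * R ^ 2 * |c| * (1 / r) := by ring
    _ ≤ 2 * R * B * X + 2 * R ^ 2 * |c| * (Λ * X) := by gcongr; norm_num
    _ = _ := by ring

end Mass

theorem PiecewiseSmooth.intervalIntegrable {h : ℝ → ℝ} {a b : ℝ} (H : PiecewiseSmooth h a b) :
    IntervalIntegrable h volume a b := by
  obtain ⟨n, t, rfl, rfl, ht⟩ := H
  refine IntervalIntegrable.trans_iterate fun i hi => ?_
  obtain ⟨hlt, g, hg, hgh⟩ := ht i hi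
  have hint : IntervalIntegrable g volume (t i) (t (i + 1)) :=
    ContinuousOn.intervalIntegrable_of_Icc hlt.le hg.continuousOn
  rw [intervalIntegrable_iff_integrableOn_Ioo_of_le hlt.le] at hint ⊢
  exact hint.congr_fun hgh.symm measurableSet_Ioo

theorem PiecewiseSmooth.exists_finite_continuousAt {h : ℝ → ℝ} {a b : ℝ}
    (H : PiecewiseSmooth h a b) :
    ∃ B : Set ℝ, B.Finite ∧ ∀ r ∈ Ioo a b, r ∉ B → ContinuousAt h r := by
  obtain ⟨n, t, rfl, rfl, ht⟩ := H
  refine ⟨t '' Iic n, (finite_Iic n).image t, fun r hr hrB => ?_⟩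
  have hpiece (m : ℕ) (hm : m ≤ n) (hrm : r < t m) : ∃ i < n, r ∈ Ioo (t i) (t (i + 1)) := by
    induction m with
    | zero => exact absurd hr.1 hrm.not_gt
    | succ k ih =>
      rcases lt_trichotomy r (t k) with hlt | heq | hgt
      · exact ih (by omega) hlt
      · exact absurd ⟨k, mem_Iic.2 (by omega), heq.symm⟩ hrB
      · exact ⟨k, by omega, hgt, hrm⟩
  obtain ⟨i, hi, hri⟩ := hpiece n le_rfl hr.2
  obtain ⟨-, g, hg, hgh⟩ := ht i hi
  exact (hg.continuousOn.continuousAt (Icc_mem_nhds hri.1 hri.2)).congr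
    (hgh.symm.eventuallyEq_of_mem (Ioo_mem_nhds hri.1 hri.2))

namespace Slice

section Geometry

variable {M R a b r : ℝ} (S : Slice M R)

include S in
theorem M_pos : 0 < M := by linarith [S.two_mul_lt_rH, S.rH_lt]

include S in
theorem two_mul_lt_R : 2 * M < R := by linarith [S.M_pos, S.lt_R]

theorem rH_lt_R : S.rH < R := S.rH_lt.trans S.lt_R

include S in
theorem D_pos (hr : 2 * M < r) : 0 < D M r := Schwarzschild.D_pos S.M_pos.le hr

/-- The largest slope `dv/dr` attained on `Σ₀`, namely that of the outgoing null direction at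
`r = r_H`. -/
noncomputable def maxSlope : ℝ := 2 / D M S.rH

theorem maxSlope_pos : 0 < S.maxSlope := div_pos two_pos (S.D_pos S.two_mul_lt_rH)

theorem two_div_D_le_maxSlope (hr : S.rH ≤ r) : 2 / D M r ≤ S.maxSlope := by
  have hrH : 0 < S.rH := by linarith [S.two_mul_lt_rH, S.M_pos]
  have hD : D M S.rH ≤ D M r := by
    unfold D
    gcongr
    linarith [S.M_pos]
  exact div_le_div_of_nonneg_left zero_le_two (S.D_pos S.two_mul_lt_rH) hD

theorem h_mem_Icc (hr : 2 * M ≤ r) : S.h r ∈ Icc 0 S.maxSlope := by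
  rcases le_or_gt r S.rH with hrH | hrH
  · rw [S.h_horizon r ⟨hr, hrH⟩]
    exact ⟨le_rfl, S.maxSlope_pos.le⟩
  have hslope := S.two_div_D_le_maxSlope hrH.le
  rcases lt_or_ge r R with hrR | hrR
  · obtain ⟨hpos, hlt⟩ := S.h_spacelike r ⟨hrH, hrR⟩
    exact ⟨hpos.le, hlt.le.trans hslope⟩
  · rw [S.h_infinity r hrR]
    exact ⟨(div_pos two_pos (S.D_pos (S.two_mul_lt_R.trans_le hrR))).le, hslope⟩

theorem intervalIntegrable_h (ha : 2 * M ≤ a) (hb : 2 * M ≤ b) :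
    IntervalIntegrable S.h volume a b := by
  have hfrom (r : ℝ) (hr : 2 * M ≤ r) : IntervalIntegrable S.h volume (2 * M) r := by
    have hhor : IntervalIntegrable S.h volume (2 * M) S.rH := by
      refine (intervalIntegrable_const (c := (0 : ℝ))).congr fun s hs => ?_
      rw [uIoc_of_le S.two_mul_lt_rH.le] at hs
      exact (S.h_horizon s (Ioc_subset_Icc_self hs)).symm
    have hinf : IntervalIntegrable S.h volume R (max r R) := by
      refine ContinuousOn.intervalIntegrable_of_Icc (le_max_right r R) ?_
      exact ((continuousOn_two_div_D S.M_pos.le).mono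
        fun s hs => S.two_mul_lt_R.trans_le hs.1).congr fun s hs => S.h_infinity s hs.1
    refine ((hhor.trans S.h_smooth.intervalIntegrable).trans hinf).mono_set ?_
    rw [uIcc_of_le hr, uIcc_of_le (hr.trans (le_max_left r R))]
    exact Icc_subset_Icc_right (le_max_left r R)
  exact (hfrom a ha).symm.trans (hfrom b hb)

theorem height_sub_height (ha : 2 * M ≤ a) (hb : 2 * M ≤ b) :
    S.height b - S.height a = ∫ s in a..b, S.h s := by
  rw [height, height, add_sub_add_left_eq_sub, intervalIntegral.integral_interval_sub_left
    (S.intervalIntegrable_h le_rfl hb) (S.intervalIntegrable_h le_rfl ha)]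

theorem lipschitzOnWith_height :
    LipschitzOnWith S.maxSlope.toNNReal S.height (Ici (2 * M)) := by
  refine LipschitzOnWith.of_dist_le_mul fun b hb a ha => ?_
  rw [Real.coe_toNNReal _ S.maxSlope_pos.le, Real.dist_eq, Real.dist_eq,
    S.height_sub_height ha hb, ← Real.norm_eq_abs]
  refine intervalIntegral.norm_integral_le_of_norm_le_const fun s hs => ?_
  obtain ⟨hnonneg, hle⟩ := S.h_mem_Icc ((le_min ha hb).trans hs.1.le)
  rwa [Real.norm_of_nonneg hnonneg]

theorem height_le (ha : 2 * M ≤ a) (hab : a ≤ b) :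
    S.height b ≤ S.height a + S.maxSlope * (b - a) := by
  have hle := S.lipschitzOnWith_height.le_add_mul (ha.trans hab : b ∈ Ici (2 * M)) ha
  rwa [Real.coe_toNNReal _ S.maxSlope_pos.le, Real.dist_eq,
    abs_of_nonneg (sub_nonneg.2 hab)] at hle

theorem continuousOn_height : ContinuousOn S.height (Ici (2 * M)) :=
  S.lipschitzOnWith_height.continuousOn

theorem height_eq_of_le_rH (hr : 2 * M ≤ r) (hrH : r ≤ S.rH) : S.height r = S.v₀ := by
  have hzero : EqOn S.h 0 (uIcc (2 * M) r) := fun s hs => by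
    rw [uIcc_of_le hr] at hs
    exact S.h_horizon s ⟨hs.1, hs.2.trans hrH⟩
  simp [height, intervalIntegral.integral_congr hzero]

theorem hasDerivAt_height (hr : 2 * M < r) (hh : ContinuousAt S.h r) :
    HasDerivAt S.height (S.h r) r := by
  refine (intervalIntegral.integral_hasDerivAt_right (S.intervalIntegrable_h le_rfl hr.le)
    ?_ hh).const_add _
  have hint := S.intervalIntegrable_h le_rfl (b := r + 1) (by linarith)
  rw [intervalIntegrable_iff_integrableOn_Ioo_of_le (by linarith)] at hint
  exact ⟨Ioo (2 * M) (r + 1), Ioo_mem_nhds hr (by linarith), hint.aestronglyMeasurable⟩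

theorem hasDerivWithinAt_height (hr : R ≤ r) :
    HasDerivWithinAt S.height (2 / D M r) (Ici R) r := by
  have hr' : r ∈ Ioi (2 * M) := S.two_mul_lt_R.trans_le hr
  have hcont := continuousOn_two_div_D S.M_pos.le
  have hderiv : HasDerivAt (fun x => S.height R + ∫ s in R..x, 2 / D M s) (2 / D M r) r :=
    (intervalIntegral.integral_hasDerivAt_right
      (ContinuousOn.intervalIntegrable_of_Icc hr
        (hcont.mono fun s hs => S.two_mul_lt_R.trans_le hs.1))
      (hcont.stronglyMeasurableAtFilter isOpen_Ioi r hr')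
      (hcont.continuousAt (isOpen_Ioi.mem_nhds hr'))).const_add _
  refine hderiv.hasDerivWithinAt.congr_of_mem (fun x hx => ?_) hr
  rw [← sub_eq_iff_eq_add', S.height_sub_height S.two_mul_lt_R.le (S.two_mul_lt_R.le.trans hx)]
  refine intervalIntegral.integral_congr fun s hs => ?_
  rw [uIcc_of_le hx] at hs
  exact S.h_infinity s hs.1

theorem exists_finite_hasDerivAt_height :
    ∃ B : Set ℝ, B.Finite ∧ ∀ r ∈ Ioo S.rH R, r ∉ B → HasDerivAt S.height (S.h r) r := by
  obtain ⟨B, hB, hcont⟩ := S.h_smooth.exists_finite_continuousAt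
  exact ⟨B, hB, fun r hr hrB =>
    S.hasDerivAt_height (S.two_mul_lt_rH.trans hr.1) (hcont r hr hrB)⟩

/-- The part of `J⁺(Σ₀)` away from the horizon, on which time integrals are `C²`. -/
def exterior : Set (ℝ × ℝ) := S.future ∩ {p | 2 * M < p.2}

/-- The interior of `J⁺(Σ₀)`, on which one-sided derivatives are derivatives. -/
def core : Set (ℝ × ℝ) := {p | 2 * M < p.2 ∧ S.height p.2 < p.1}

theorem core_subset_exterior : S.core ⊆ S.exterior := fun _ hp => ⟨⟨hp.1.le, hp.2.le⟩, hp.1⟩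

theorem isOpen_core : IsOpen S.core := by
  have hopen : IsOpen {p : ℝ × ℝ | 2 * M < p.2} := isOpen_lt continuous_const continuous_snd
  have hcont : ContinuousOn (fun p : ℝ × ℝ => p.1 - S.height p.2) {p | 2 * M < p.2} :=
    continuousOn_fst.sub
      (S.continuousOn_height.comp continuousOn_snd fun _ hp => mem_Ici.2 (le_of_lt hp))
  convert hcont.isOpen_inter_preimage hopen (isOpen_Ioi (a := 0)) using 1
  ext p
  simp [core]

theorem exterior_subset_closure_core : S.exterior ⊆ closure S.core := by
  rintro ⟨v, r⟩ ⟨⟨-, hv⟩, hr⟩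
  have hlim : Tendsto (fun s : ℝ => (s, r)) (𝓝[>] v) (𝓝 (v, r)) :=
    ((continuous_id.prodMk continuous_const).tendsto v).mono_left nhdsWithin_le_nhds
  exact mem_closure_of_tendsto hlim
    (eventually_mem_nhdsWithin.mono fun s hs => ⟨hr, hv.trans_lt hs⟩)

theorem pt_mem_future (hr : 2 * M ≤ r) : S.pt r ∈ S.future := ⟨hr, le_rfl⟩

theorem pt_mem_exterior (hr : 2 * M < r) : S.pt r ∈ S.exterior := ⟨S.pt_mem_future hr.le, hr⟩

end Geometry

end Slice

theorem uniqueDiffWithinAt_cone (k : ℝ) (p : ℝ × ℝ) :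
    UniqueDiffWithinAt ℝ {q : ℝ × ℝ | p.2 ≤ q.2 ∧ p.1 - k * p.2 ≤ q.1 - k * q.2} p := by
  have hconv : Convex ℝ {q : ℝ × ℝ | p.2 ≤ q.2 ∧ p.1 - k * p.2 ≤ q.1 - k * q.2} :=
    (convex_halfSpace_ge (LinearMap.snd ℝ ℝ ℝ).isLinear _).inter
      (convex_halfSpace_ge (LinearMap.fst ℝ ℝ ℝ - k • LinearMap.snd ℝ ℝ ℝ).isLinear _)
  have hopen : IsOpen {q : ℝ × ℝ | p.2 < q.2 ∧ p.1 - k * p.2 < q.1 - k * q.2} :=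
    .and (isOpen_lt (by fun_prop) (by fun_prop)) (isOpen_lt (by fun_prop) (by fun_prop))
  refine uniqueDiffWithinAt_convex hconv ⟨(p.1 + k + 1, p.2 + 1), ?_⟩
    (subset_closure ⟨le_rfl, le_rfl⟩)
  refine mem_interior.2 ⟨_, fun q hq => ⟨hq.1.le, hq.2.le⟩, hopen, ?_, ?_⟩
  · exact lt_add_one _
  · change _ < p.1 + k + 1 - k * (p.2 + 1)
    linarith

namespace Slice

variable {M R : ℝ} (S : Slice M R)

theorem uniqueDiffOn_future : UniqueDiffOn ℝ S.future := fun p hp =>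
  (uniqueDiffWithinAt_cone S.maxSlope p).mono fun q ⟨hq₂, hq₁⟩ =>
    ⟨hp.1.trans hq₂, by linarith [S.height_le hp.1 hq₂, hp.2]⟩

theorem uniqueDiffOn_exterior : UniqueDiffOn ℝ S.exterior :=
  S.uniqueDiffOn_future.inter (isOpen_lt continuous_const continuous_snd)

end Slice

section Box

variable {M : ℝ} {x : Fin 4 → ℝ} {i : Fin 4}

theorem metric_det (M : ℝ) (x : Fin 4 → ℝ) :
    (metric M x).det = -(x 1 ^ 2 * Real.sin (x 2)) ^ 2 := by
  simp [metric, Matrix.det_succ_row_zero, Fin.sum_univ_succ, Fin.succAbove]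
  ring

theorem sqrt_abs_metric_det (M : ℝ) (x : Fin 4 → ℝ) :
    √|(metric M x).det| = x 1 ^ 2 * |Real.sin (x 2)| := by
  rw [metric_det, abs_neg, abs_of_nonneg (sq_nonneg _), Real.sqrt_sq_eq_abs, abs_mul,
    abs_of_nonneg (sq_nonneg _)]

theorem metric_inv (M : ℝ) (hr : x 1 ≠ 0) (hθ : Real.sin (x 2) ≠ 0) :
    (metric M x)⁻¹ = !![0, 1, 0, 0; 1, D M (x 1), 0, 0; 0, 0, (x 1 ^ 2)⁻¹, 0;
      0, 0, 0, (x 1 ^ 2 * Real.sin (x 2) ^ 2)⁻¹] := by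
  apply Matrix.inv_eq_right_inv
  ext i j
  fin_cases i <;> fin_cases j <;> simp [metric, Matrix.mul_apply, Fin.sum_univ_succ, hr]
  field_simp

theorem pd_eq_of_hasDerivAt {F : (Fin 4 → ℝ) → ℝ} {g : ℝ → ℝ} {c : ℝ}
    (hg : HasDerivAt g c (x i)) (hF : ∀ᶠ s in 𝓝 (x i), F (Function.update x i s) = g s) :
    pd i F x = c :=
  (hg.congr_of_eventuallyEq hF).deriv

variable {f : ℝ × ℝ → ℝ}

theorem pd_zero_lift (hf : DifferentiableAt ℝ f (x 0, x 1)) :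
    pd 0 (lift f) x = fderiv ℝ f (x 0, x 1) (1, 0) := by
  have hline : HasDerivAt (fun s : ℝ => (s, x 1)) (1, 0) (x 0) :=
    (hasDerivAt_id _).prodMk (hasDerivAt_const _ _)
  exact pd_eq_of_hasDerivAt (hf.hasFDerivAt.comp_hasDerivAt (x 0) hline)
    (Eventually.of_forall fun s => by simp [lift])

theorem pd_one_lift (hf : DifferentiableAt ℝ f (x 0, x 1)) :
    pd 1 (lift f) x = fderiv ℝ f (x 0, x 1) (0, 1) := by
  have hline : HasDerivAt (fun s : ℝ => (x 0, s)) (0, 1) (x 1) :=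
    (hasDerivAt_const _ _).prodMk (hasDerivAt_id _)
  exact pd_eq_of_hasDerivAt (hf.hasFDerivAt.comp_hasDerivAt (x 1) hline)
    (Eventually.of_forall fun s => by simp [lift])

theorem pd_lift_eq_zero (hi₀ : i ≠ 0) (hi₁ : i ≠ 1) : pd i (lift f) x = 0 := by
  simp [pd, lift, hi₀.symm, hi₁.symm]

/-- The components `|det g|^{1/2} g^{ij} ∂_j F` of the gradient density of `F`, whose divergence
is `|det g|^{1/2} □_g F`. -/
noncomputable def gradDensity (M : ℝ) (F : (Fin 4 → ℝ) → ℝ) (i : Fin 4) (x : Fin 4 → ℝ) : ℝ :=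
  √|(metric M x).det| * ∑ j, (metric M x)⁻¹ i j * pd j F x

theorem gradDensity_lift_zero (hr : x 1 ≠ 0) (hθ : Real.sin (x 2) ≠ 0)
    (hf : DifferentiableAt ℝ f (x 0, x 1)) :
    gradDensity M (lift f) 0 x =
      |Real.sin (x 2)| * (x 1 ^ 2 * fderiv ℝ f (x 0, x 1) (0, 1)) := by
  rw [gradDensity, sqrt_abs_metric_det, metric_inv M hr hθ, Fin.sum_univ_four, pd_one_lift hf]
  simp
  ring

theorem gradDensity_lift_one (hr : x 1 ≠ 0) (hθ : Real.sin (x 2) ≠ 0)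
    (hf : DifferentiableAt ℝ f (x 0, x 1)) :
    gradDensity M (lift f) 1 x = |Real.sin (x 2)| * (x 1 ^ 2 *
      (fderiv ℝ f (x 0, x 1) (1, 0) + D M (x 1) * fderiv ℝ f (x 0, x 1) (0, 1))) := by
  rw [gradDensity, sqrt_abs_metric_det, metric_inv M hr hθ, Fin.sum_univ_four, pd_zero_lift hf,
    pd_one_lift hf]
  simp
  ring

theorem gradDensity_lift_eq_zero (hr : x 1 ≠ 0) (hθ : Real.sin (x 2) ≠ 0) (hi₀ : i ≠ 0)
    (hi₁ : i ≠ 1) : gradDensity M (lift f) i x = 0 := by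
  rw [gradDensity, metric_inv M hr hθ, Fin.sum_univ_four, pd_lift_eq_zero (i := 2) (by decide)
    (by decide), pd_lift_eq_zero (i := 3) (by decide) (by decide)]
  fin_cases i <;> simp_all

theorem hasFDerivAt_fderiv_apply {p : ℝ × ℝ} (hf : ContDiffAt ℝ 2 f p) (w : ℝ × ℝ) :
    HasFDerivAt (fun q => fderiv ℝ f q w) ((fderiv ℝ (fderiv ℝ f) p).flip w) p := by
  simpa using ((hf.fderiv_right (m := 1) le_rfl).differentiableAt one_ne_zero).hasFDerivAt.clm_apply
    (hasFDerivAt_const w p)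

variable {v r θ α : ℝ}

theorem pd_gradDensity_lift_zero (hr : r ≠ 0) (hθ : Real.sin θ ≠ 0)
    (hf : ContDiffAt ℝ 2 f (v, r)) :
    pd 0 (gradDensity M (lift f) 0) ![v, r, θ, α] =
      |Real.sin θ| * (r ^ 2 * fderiv ℝ (fderiv ℝ f) (v, r) (1, 0) (0, 1)) := by
  have hline : HasDerivAt (fun s : ℝ => (s, r)) (1, 0) v :=
    (hasDerivAt_id v).prodMk (hasDerivAt_const v r)
  refine pd_eq_of_hasDerivAt ((((hasFDerivAt_fderiv_apply hf (0, 1)).comp_hasDerivAt v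
    hline).const_mul (r ^ 2)).const_mul |Real.sin θ|) ?_
  filter_upwards [hline.continuousAt.eventually (hf.eventually (by simp))] with s hs
  rw [gradDensity_lift_zero] <;> simp [hr, hθ, hs.differentiableAt]

theorem pd_gradDensity_lift_one (hr : r ≠ 0) (hθ : Real.sin θ ≠ 0)
    (hf : ContDiffAt ℝ 2 f (v, r)) :
    pd 1 (gradDensity M (lift f) 1) ![v, r, θ, α] =
      |Real.sin θ| * (2 * r * (fderiv ℝ f (v, r) (1, 0) + D M r * fderiv ℝ f (v, r) (0, 1)) +
        r ^ 2 * (fderiv ℝ (fderiv ℝ f) (v, r) (0, 1) (1, 0) +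
          (2 * M / r ^ 2 * fderiv ℝ f (v, r) (0, 1) +
            D M r * fderiv ℝ (fderiv ℝ f) (v, r) (0, 1) (0, 1)))) := by
  have hline : HasDerivAt (fun s : ℝ => (v, s)) (0, 1) r :=
    (hasDerivAt_const r v).prodMk (hasDerivAt_id r)
  have hderiv (w : ℝ × ℝ) := (hasFDerivAt_fderiv_apply hf w).comp_hasDerivAt r hline
  refine (pd_eq_of_hasDerivAt (((hasDerivAt_pow 2 r).mul ((hderiv (1, 0)).add
    ((hasDerivAt_D (M := M) hr).mul (hderiv (0, 1))))).const_mul |Real.sin θ|) ?_).trans (by simp)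
  filter_upwards [hline.continuousAt.eventually (hf.eventually (by simp)),
    eventually_ne_nhds hr] with s hs hs0
  rw [gradDensity_lift_one] <;> simp [hs0, hθ, hs.differentiableAt]

theorem pd_gradDensity_lift_eq_zero (hr : r ≠ 0) (hθ : Real.sin θ ≠ 0) (hi₀ : i ≠ 0)
    (hi₁ : i ≠ 1) : pd i (gradDensity M (lift f) i) ![v, r, θ, α] = 0 := by
  refine pd_eq_of_hasDerivAt (hasDerivAt_const _ 0) ?_
  have hsin : ∀ᶠ s in 𝓝 (![v, r, θ, α] i),
      Real.sin (Function.update ![v, r, θ, α] i s 2) ≠ 0 := by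
    refine ContinuousAt.eventually_ne (by fun_prop) ?_
    simpa using hθ
  filter_upwards [hsin] with s hs
  exact gradDensity_lift_eq_zero (by simpa [hi₁.symm] using hr) hs hi₀ hi₁

theorem sq_mul_box_lift (hr : r ≠ 0) (hθ : Real.sin θ ≠ 0) (hf : ContDiffAt ℝ 2 f (v, r)) :
    r ^ 2 * box (metric M) (lift f) ![v, r, θ, α] =
      2 * r ^ 2 * fderiv ℝ (fderiv ℝ f) (v, r) (1, 0) (0, 1) +
        r ^ 2 * D M r * fderiv ℝ (fderiv ℝ f) (v, r) (0, 1) (0, 1) +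
        2 * r * fderiv ℝ f (v, r) (1, 0) +
        (2 * r * D M r + 2 * M) * fderiv ℝ f (v, r) (0, 1) := by
  have hsymm : fderiv ℝ (fderiv ℝ f) (v, r) (0, 1) (1, 0) =
      fderiv ℝ (fderiv ℝ f) (v, r) (1, 0) (0, 1) :=
    hf.isSymmSndFDerivAt (by simp) (0, 1) (1, 0)
  have hdiv : box (metric M) (lift f) ![v, r, θ, α] = (√|(metric M ![v, r, θ, α]).det|)⁻¹ *
      ∑ i, pd i (gradDensity M (lift f) i) ![v, r, θ, α] := rfl
  rw [hdiv, sqrt_abs_metric_det, Fin.sum_univ_four, pd_gradDensity_lift_zero hr hθ hf,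
    pd_gradDensity_lift_one hr hθ hf,
    pd_gradDensity_lift_eq_zero (i := 2) hr hθ (by decide) (by decide),
    pd_gradDensity_lift_eq_zero (i := 3) hr hθ (by decide) (by decide), hsymm]
  have hsin : |Real.sin θ| ≠ 0 := abs_ne_zero.2 hθ
  simp only [Matrix.cons_val]
  field_simp
  ring

end Box

namespace Slice

section Derivatives

variable {M R : ℝ} {S : Slice M R} {f : ℝ × ℝ → ℝ} {p : ℝ × ℝ}

theorem fderivWithin_exterior (f : ℝ × ℝ → ℝ) (hp : p ∈ S.exterior) :
    fderivWithin ℝ f S.exterior p = fderivWithin ℝ f S.future p :=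
  fderivWithin_inter ((isOpen_lt continuous_const continuous_snd).mem_nhds hp.2)

theorem fderivWithin_core (f : ℝ × ℝ → ℝ) (hp : p ∈ S.core) :
    fderivWithin ℝ f S.future p = fderiv ℝ f p := by
  rw [← fderivWithin_exterior f (S.core_subset_exterior hp)]
  exact fderivWithin_of_mem_nhds
    (mem_of_superset (S.isOpen_core.mem_nhds hp) S.core_subset_exterior)

theorem differentiableWithinAt_future (hf : ContDiffOn ℝ 1 f S.exterior) (hp : p ∈ S.exterior) :
    DifferentiableWithinAt ℝ f S.future p :=
  (differentiableWithinAt_inter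
    ((isOpen_lt continuous_const continuous_snd).mem_nhds hp.2)).1
      (hf.differentiableOn one_ne_zero p hp)

theorem contDiffOn_fderivWithin_apply {m n : WithTop ℕ∞} (hf : ContDiffOn ℝ n f S.exterior)
    (hmn : m + 1 ≤ n) (w : ℝ × ℝ) :
    ContDiffOn ℝ m (fun p => fderivWithin ℝ f S.future p w) S.exterior :=
  ((hf.fderivWithin S.uniqueDiffOn_exterior hmn).clm_apply contDiffOn_const).congr
    fun p hp => by rw [fderivWithin_exterior f hp]

theorem continuousOn_fderivWithin_apply (hf : ContDiffOn ℝ 1 f S.exterior) (w : ℝ × ℝ) :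
    ContinuousOn (fun p => fderivWithin ℝ f S.future p w) S.exterior :=
  (contDiffOn_fderivWithin_apply hf (zero_add 1).le w).continuousOn

theorem contDiffAt_of_mem_core {n : WithTop ℕ∞} (hf : ContDiffOn ℝ n f S.exterior)
    (hp : p ∈ S.core) : ContDiffAt ℝ n f p :=
  hf.contDiffAt (mem_of_superset (S.isOpen_core.mem_nhds hp) S.core_subset_exterior)

theorem fderivWithin_fderivWithin_core (hf : ContDiffOn ℝ 2 f S.exterior) (hp : p ∈ S.core)
    (u w : ℝ × ℝ) :
    fderivWithin ℝ (fun q => fderivWithin ℝ f S.future q w) S.future p u =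
      fderiv ℝ (fderiv ℝ f) p u w := by
  have hev : (fun q => fderivWithin ℝ f S.future q w) =ᶠ[𝓝 p] fun q => fderiv ℝ f q w := by
    filter_upwards [S.isOpen_core.mem_nhds hp] with q hq
    rw [fderivWithin_core f hq]
  rw [fderivWithin_core _ hp, hev.fderiv_eq,
    (hasFDerivAt_fderiv_apply (contDiffAt_of_mem_core hf hp) w).fderiv,
    ContinuousLinearMap.flip_apply]

theorem dv_dr_comm (hf : ContDiffOn ℝ 2 f S.exterior) (hp : p ∈ S.exterior) :
    S.dv (S.dr f) p = S.dr (S.dv f) p := by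
  have hcont (u w : ℝ × ℝ) : ContinuousOn
      (fun q => fderivWithin ℝ (fun q => fderivWithin ℝ f S.future q w) S.future q u) S.exterior :=
    continuousOn_fderivWithin_apply (contDiffOn_fderivWithin_apply hf le_rfl w) u
  refine EqOn.of_subset_closure (fun q hq => ?_) (hcont (1, 0) (0, 1)) (hcont (0, 1) (1, 0))
    S.core_subset_exterior S.exterior_subset_closure_core hp
  rw [fderivWithin_fderivWithin_core hf hq, fderivWithin_fderivWithin_core hf hq]
  exact (contDiffAt_of_mem_core hf hq).isSymmSndFDerivAt (by simp) (1, 0) (0, 1)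

theorem SolvesWave.radial_eq_core (hw : S.SolvesWave f) (hf : ContDiffOn ℝ 2 f S.exterior)
    (hp : p ∈ S.core) :
    2 * p.2 ^ 2 * S.dv (S.dr f) p + p.2 ^ 2 * D M p.2 * S.dr (S.dr f) p + 2 * p.2 * S.dv f p +
      (2 * p.2 * D M p.2 + 2 * M) * S.dr f p = 0 := by
  have hr : p.2 ≠ 0 := (S.M_pos.trans (by linarith [hp.1, S.M_pos])).ne'
  have hbox := sq_mul_box_lift (M := M) (θ := Real.pi / 2) (α := 0) hr (by simp)
    (contDiffAt_of_mem_core hf hp)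
  rw [hw p.1 p.2 _ 0 hp.1 hp.2 ⟨by positivity, by linarith [Real.pi_pos]⟩, mul_zero,
    ← fderivWithin_fderivWithin_core hf hp, ← fderivWithin_fderivWithin_core hf hp,
    ← fderivWithin_core f hp] at hbox
  exact hbox.symm

theorem SolvesWave.radial_eq (hw : S.SolvesWave f) (hf : ContDiffOn ℝ 2 f S.exterior)
    (hp : p ∈ S.exterior) :
    2 * p.2 ^ 2 * S.dv (S.dr f) p + p.2 ^ 2 * D M p.2 * S.dr (S.dr f) p + 2 * p.2 * S.dv f p +
      (2 * p.2 * D M p.2 + 2 * M) * S.dr f p = 0 := by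
  have hD : ContinuousOn (fun q : ℝ × ℝ => D M q.2) S.exterior :=
    (continuousOn_D S.M_pos.le).comp continuousOn_snd fun _ hq => hq.2
  have hfirst (w : ℝ × ℝ) := contDiffOn_fderivWithin_apply hf (m := 1) le_rfl w
  have hdr : ContinuousOn (S.dr f) S.exterior := (hfirst (0, 1)).continuousOn
  have hdv : ContinuousOn (S.dv f) S.exterior := (hfirst (1, 0)).continuousOn
  have hdvdr : ContinuousOn (S.dv (S.dr f)) S.exterior :=
    continuousOn_fderivWithin_apply (hfirst (0, 1)) (1, 0)
  have hdrdr : ContinuousOn (S.dr (S.dr f)) S.exterior :=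
    continuousOn_fderivWithin_apply (hfirst (0, 1)) (0, 1)
  exact EqOn.of_subset_closure (g := fun _ => (0 : ℝ)) (fun q hq => hw.radial_eq_core hf hq)
    (by fun_prop) continuousOn_const S.core_subset_exterior S.exterior_subset_closure_core hp

theorem dr_rmul (hp : p ∈ S.future) (hf : DifferentiableWithinAt ℝ f S.future p) :
    S.dr (rmul f) p = f p + p.2 * S.dr f p := by
  have hmul := hasFDerivWithinAt_snd.mul hf.hasFDerivWithinAt
  rw [dr, hmul.fderivWithin (f := rmul f) (S.uniqueDiffOn_future p hp)]
  simp [dr, add_comm]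

theorem dv_rmul (hp : p ∈ S.future) (hf : DifferentiableWithinAt ℝ f S.future p) :
    S.dv (rmul f) p = p.2 * S.dv f p := by
  have hmul := hasFDerivWithinAt_snd.mul hf.hasFDerivWithinAt
  rw [dv, hmul.fderivWithin (f := rmul f) (S.uniqueDiffOn_future p hp)]
  simp [dv]

variable {s : Set ℝ} {r h' : ℝ}

theorem continuousOn_pt : ContinuousOn S.pt (Ici (2 * M)) :=
  S.continuousOn_height.prodMk continuousOn_id

theorem continuousOn_comp_pt (hf : ContinuousOn f S.exterior) :
    ContinuousOn (fun r => f (S.pt r)) (Ioi (2 * M)) :=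
  hf.comp (continuousOn_pt.mono Ioi_subset_Ici_self) fun _ hr => S.pt_mem_exterior hr

theorem hasDerivWithinAt_comp_pt (hs : s ⊆ Ici (2 * M))
    (hf : DifferentiableWithinAt ℝ f S.future (S.pt r)) (hh : HasDerivWithinAt S.height h' s r) :
    HasDerivWithinAt (fun x => f (S.pt x)) (S.dr f (S.pt r) + h' * S.dv f (S.pt r)) s r := by
  have hpt : HasDerivWithinAt S.pt ((0, 1) + h' • (1, 0)) s r :=
    (hh.prodMk (hasDerivWithinAt_id r s)).congr_deriv (by simp)
  refine (hf.hasFDerivWithinAt.comp_hasDerivWithinAt r hpt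
    fun x hx => S.pt_mem_future (hs hx)).congr_deriv ?_
  rw [map_add, map_smul]
  rfl

end Derivatives

/-- The flux `D r² ∂_r f` through the sphere of area radius `r` of `Σ₀`, with `∂_r` transversal
to `Σ₀`, taken in `(v, r)`-coordinates. -/
noncomputable def flux {M R : ℝ} (S : Slice M R) (f : ℝ × ℝ → ℝ) (r : ℝ) : ℝ :=
  r ^ 2 * D M r * S.dr f (S.pt r)

theorem normal_mul_volDensity {M R r : ℝ} (S : Slice M R) (φ : ℝ × ℝ → ℝ)
    (hr : r ∈ Ioo S.rH R) :
    S.normal φ r * S.volDensity r =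
      r ^ 2 * (S.h r * S.dv φ (S.pt r) - (1 - D M r * S.h r) * S.dr φ (S.pt r)) := by
  obtain ⟨hpos, hlt⟩ := S.h_spacelike r hr
  rw [lt_div_iff₀ (S.D_pos (S.two_mul_lt_rH.trans hr.1))] at hlt
  have hsqrt : 0 < √(S.h r * (2 - D M r * S.h r)) :=
    Real.sqrt_pos.2 (mul_pos hpos (by linarith))
  rw [normal, volDensity, mul_left_comm, div_mul_cancel₀ _ hsqrt.ne']

theorem mul_Lbar_rmul {M R r : ℝ} {S : Slice M R} {f : ℝ × ℝ → ℝ} (hr : 2 * M < r)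
    (hf : DifferentiableWithinAt ℝ f S.future (S.pt r)) :
    r * S.Lbar (rmul f) (S.pt r) * (2 / D M r) = -(r * f (S.pt r) + r ^ 2 * S.dr f (S.pt r)) := by
  have hD := S.D_pos hr
  rw [Lbar, dr_rmul (S.pt_mem_future hr.le) hf]
  simp only [pt]
  field_simp

namespace IsTimeIntegral

variable {M R : ℝ} {S : Slice M R} {φ φ₁ : ℝ × ℝ → ℝ}

theorem contDiffOn (h₁ : S.IsTimeIntegral φ φ₁) : ContDiffOn ℝ 1 φ S.exterior :=
  (contDiffOn_fderivWithin_apply (m := 1) h₁.regular le_rfl (1, 0)).congr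
    fun p hp => (h₁.time_deriv p hp.1 hp.2).symm

theorem differentiableWithinAt (h₁ : S.IsTimeIntegral φ φ₁) {r : ℝ} (hr : 2 * M < r) :
    DifferentiableWithinAt ℝ φ S.future (S.pt r) :=
  differentiableWithinAt_future h₁.contDiffOn (S.pt_mem_exterior hr)

theorem dv_dr (h₁ : S.IsTimeIntegral φ φ₁) {p : ℝ × ℝ} (hp : p ∈ S.exterior) :
    S.dv (S.dr φ₁) p = S.dr φ p := by
  rw [dv_dr_comm h₁.regular hp, dr, dr, ← fderivWithin_exterior _ hp, ← fderivWithin_exterior _ hp,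
    fderivWithin_congr (fun q hq => h₁.time_deriv q hq.1 hq.2) (h₁.time_deriv p hp.1 hp.2)]

theorem continuousOn_comp_pt (h₁ : S.IsTimeIntegral φ φ₁) :
    ContinuousOn (fun r => φ (S.pt r)) (Ioi (2 * M)) :=
  Slice.continuousOn_comp_pt h₁.contDiffOn.continuousOn

theorem continuousOn_dr_comp_pt (h₁ : S.IsTimeIntegral φ φ₁) :
    ContinuousOn (fun r => S.dr φ (S.pt r)) (Ioi (2 * M)) :=
  Slice.continuousOn_comp_pt (continuousOn_fderivWithin_apply h₁.contDiffOn (0, 1))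

theorem continuousOn_dv_comp_pt (h₁ : S.IsTimeIntegral φ φ₁) :
    ContinuousOn (fun r => S.dv φ (S.pt r)) (Ioi (2 * M)) :=
  Slice.continuousOn_comp_pt (continuousOn_fderivWithin_apply h₁.contDiffOn (1, 0))

theorem hasDerivWithinAt_flux (h₁ : S.IsTimeIntegral φ φ₁) {s : Set ℝ} {r h' : ℝ}
    (hs : s ⊆ Ici (2 * M)) (hr : 2 * M < r) (hh : HasDerivWithinAt S.height h' s r) :
    HasDerivWithinAt (S.flux φ₁)
      (-2 * r * φ (S.pt r) - 2 * r ^ 2 * S.dr φ (S.pt r) + h' * (r ^ 2 * D M r * S.dr φ (S.pt r)))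
      s r := by
  have hr0 : r ≠ 0 := (S.M_pos.trans (by linarith [S.M_pos])).ne'
  have hp := S.pt_mem_exterior hr
  have hdr : DifferentiableWithinAt ℝ (S.dr φ₁) S.future (S.pt r) := differentiableWithinAt_future
    (contDiffOn_fderivWithin_apply (m := 1) h₁.regular le_rfl (0, 1)) hp
  have hwave := h₁.wave.radial_eq h₁.regular hp
  rw [h₁.dv_dr hp, h₁.time_deriv _ hp.1 hp.2] at hwave
  refine ((((hasDerivAt_pow 2 r).mul (hasDerivAt_D (M := M) hr0)).hasDerivWithinAt).mul
    (hasDerivWithinAt_comp_pt hs hdr hh)).congr_deriv ?_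
  rw [h₁.dv_dr hp]
  have hD' : r ^ 2 * (2 * M / r ^ 2) = 2 * M := by field_simp
  change 2 * r ^ 2 * S.dr φ (S.pt r) + r ^ 2 * D M r * S.dr (S.dr φ₁) (S.pt r) +
    2 * r * φ (S.pt r) + (2 * r * D M r + 2 * M) * S.dr φ₁ (S.pt r) = 0 at hwave
  simp only [Pi.mul_apply]
  push_cast
  linear_combination hwave + S.dr φ₁ (S.pt r) * hD'

theorem continuousOn_flux (h₁ : S.IsTimeIntegral φ φ₁) :
    ContinuousOn (S.flux φ₁) (Ioi (2 * M)) := by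
  have hdr : ContinuousOn (fun r => S.dr φ₁ (S.pt r)) (Ioi (2 * M)) := Slice.continuousOn_comp_pt
    (continuousOn_fderivWithin_apply (h₁.regular.of_le one_le_two) (0, 1))
  exact ((continuous_pow 2).continuousOn.mul (continuousOn_D S.M_pos.le)).mul hdr

theorem tendsto_flux_horizon (h₁ : S.IsTimeIntegral φ φ₁) :
    Tendsto (S.flux φ₁) (𝓝[>] (2 * M)) (𝓝 0) := by
  have hsq : Tendsto (fun r : ℝ => -2 * r ^ 2) (𝓝[>] (2 * M)) (𝓝 (-2 * (2 * M) ^ 2)) :=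
    ((by fun_prop : Continuous fun r : ℝ => -2 * r ^ 2).tendsto _).mono_left nhdsWithin_le_nhds
  have hlim := hsq.mul h₁.lim_horizon
  rw [mul_zero] at hlim
  refine hlim.congr' ?_
  filter_upwards [Ioo_mem_nhdsGT S.two_mul_lt_rH] with r hr
  rw [flux, pt, S.height_eq_of_le_rH hr.1.le hr.2.le, Lbar]
  ring

theorem hasDerivAt_flux_of_lt_rH (h₁ : S.IsTimeIntegral φ φ₁) {r : ℝ}
    (hr : r ∈ Ioo (2 * M) S.rH) :
    HasDerivAt (S.flux φ₁) (2 * (r * S.Lbar (rmul φ) (S.pt r) * (2 / D M r))) r := by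
  have hheight : HasDerivWithinAt S.height 0 (Ioo (2 * M) S.rH) r :=
    (hasDerivWithinAt_const r _ S.v₀).congr_of_mem
      (fun x hx => S.height_eq_of_le_rH hx.1.le hx.2.le) hr
  refine ((h₁.hasDerivWithinAt_flux (fun x hx => hx.1.le) hr.1 hheight).hasDerivAt
    (Ioo_mem_nhds hr.1 hr.2)).congr_deriv ?_
  rw [mul_Lbar_rmul hr.1 (h₁.differentiableWithinAt hr.1)]
  ring

theorem intervalIntegrable_Lbar (h₁ : S.IsTimeIntegral φ φ₁) (hφ : ContDiffOn ℝ 1 φ S.future) :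
    IntervalIntegrable (fun r => r * S.Lbar (rmul φ) (S.pt r) * (2 / D M r)) volume
      (2 * M) S.rH := by
  have hmaps : MapsTo S.pt (Ici (2 * M)) S.future := fun _ hr => S.pt_mem_future hr
  have hφc : ContinuousOn (fun r => φ (S.pt r)) (Ici (2 * M)) :=
    hφ.continuousOn.comp continuousOn_pt hmaps
  have hdr : ContinuousOn (fun r => S.dr φ (S.pt r)) (Ici (2 * M)) :=
    ((hφ.continuousOn_fderivWithin S.uniqueDiffOn_future le_rfl).clm_apply
      continuousOn_const).comp continuousOn_pt hmaps
  have hcont : ContinuousOn (fun r => -(r * φ (S.pt r) + r ^ 2 * S.dr φ (S.pt r)))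
      (Icc (2 * M) S.rH) :=
    ((continuousOn_id.mul hφc).add ((continuous_pow 2).continuousOn.mul hdr)).neg.mono
      Icc_subset_Ici_self
  refine (hcont.intervalIntegrable_of_Icc S.two_mul_lt_rH.le).congr fun r hr => ?_
  rw [uIoc_of_le S.two_mul_lt_rH.le] at hr
  exact (mul_Lbar_rmul hr.1 (h₁.differentiableWithinAt hr.1)).symm

theorem flux_rH (h₁ : S.IsTimeIntegral φ φ₁) (hφ : ContDiffOn ℝ 1 φ S.future) :
    S.flux φ₁ S.rH = 2 * ∫ r in (2 * M)..S.rH, r * S.Lbar (rmul φ) (S.pt r) * (2 / D M r) := by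
  have hright : Tendsto (S.flux φ₁) (𝓝[<] S.rH) (𝓝 (S.flux φ₁ S.rH)) :=
    (h₁.continuousOn_flux.continuousAt (Ioi_mem_nhds S.two_mul_lt_rH)).tendsto.mono_left
      nhdsWithin_le_nhds
  rw [← sub_zero (S.flux φ₁ S.rH), ← intervalIntegral.integral_const_mul]
  exact (intervalIntegral.integral_eq_sub_of_hasDerivAt_of_tendsto S.two_mul_lt_rH
    (fun r hr => h₁.hasDerivAt_flux_of_lt_rH hr) ((h₁.intervalIntegrable_Lbar hφ).const_mul 2)
    h₁.tendsto_flux_horizon hright).symm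

theorem intervalIntegrable_normal (h₁ : S.IsTimeIntegral φ φ₁) :
    IntervalIntegrable (fun r => S.normal φ r * S.volDensity r) volume S.rH R := by
  have hsub : uIcc S.rH R ⊆ Ioi (2 * M) := by
    rw [uIcc_of_le S.rH_lt_R.le]
    exact fun r hr => S.two_mul_lt_rH.trans_le hr.1
  have hD := continuousOn_D S.M_pos.le
  have hdr := h₁.continuousOn_dr_comp_pt
  have hdv := h₁.continuousOn_dv_comp_pt
  have hslope : IntervalIntegrable
      (fun r => S.h r * (r ^ 2 * (S.dv φ (S.pt r) + D M r * S.dr φ (S.pt r)))) volume S.rH R :=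
    S.h_smooth.intervalIntegrable.mul_continuousOn (ContinuousOn.mono (by fun_prop) hsub)
  have hradial : IntervalIntegrable (fun r => r ^ 2 * S.dr φ (S.pt r)) volume S.rH R :=
    (ContinuousOn.mono (by fun_prop) hsub).intervalIntegrable
  refine (hslope.sub hradial).congr_uIoo fun r hr => ?_
  rw [uIoo_of_le S.rH_lt_R.le] at hr
  rw [S.normal_mul_volDensity φ hr]
  ring

theorem hasDerivAt_flux_add (h₁ : S.IsTimeIntegral φ φ₁) {r : ℝ} (hr : r ∈ Ioo S.rH R)
    (hh : HasDerivAt S.height (S.h r) r) :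
    HasDerivAt (fun r => S.flux φ₁ r + r ^ 2 * φ (S.pt r)) (S.normal φ r * S.volDensity r) r := by
  have hr' : 2 * M < r := S.two_mul_lt_rH.trans hr.1
  have hflux := h₁.hasDerivWithinAt_flux subset_rfl hr' hh.hasDerivWithinAt
  have hφ := hasDerivWithinAt_comp_pt subset_rfl (h₁.differentiableWithinAt hr')
    hh.hasDerivWithinAt
  refine ((hflux.add ((hasDerivAt_pow 2 r).hasDerivWithinAt.mul hφ)).hasDerivAt
    (Ici_mem_nhds hr')).congr_deriv ?_
  rw [S.normal_mul_volDensity φ hr]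
  push_cast
  ring

theorem flux_R (h₁ : S.IsTimeIntegral φ φ₁) (hφ : ContDiffOn ℝ 1 φ S.future) :
    S.flux φ₁ R + 2 * R ^ 2 * φ (S.pt R) = S.C₀' φ := by
  obtain ⟨B, hB, hheight⟩ := S.exists_finite_hasDerivAt_height
  have hcont : ContinuousOn (fun r => S.flux φ₁ r + r ^ 2 * φ (S.pt r)) (Icc S.rH R) :=
    (h₁.continuousOn_flux.add ((continuous_pow 2).continuousOn.mul h₁.continuousOn_comp_pt)).mono
      fun r hr => S.two_mul_lt_rH.trans_le hr.1
  have hint := integral_eq_of_hasDerivAt_off_countable_of_le _ _ S.rH_lt_R.le hB.countable hcont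
    (fun r hr => h₁.hasDerivAt_flux_add hr.1 (hheight r hr.1 hr.2)) h₁.intervalIntegrable_normal
  rw [C₀', hint, ← h₁.flux_rH hφ]
  ring

end IsTimeIntegral

/-- The flux `D r² ∂_r φ₁` through the sphere of area radius `r ≥ R` of `Σ₀`, with `∂_r` now
tangent to `Σ₀` and `φ` in the place of `T φ₁`. -/
noncomputable def nullFlux {M R : ℝ} (S : Slice M R) (φ φ₁ : ℝ × ℝ → ℝ) (r : ℝ) : ℝ :=
  S.flux φ₁ r + 2 * r ^ 2 * φ (S.pt r)

section Infinity

theorem abs_two_mul_le_rpow {q β K r : ℝ} (hβ : 0 < β) (hr : 0 < r)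
    (hq : |q| ≤ K * r ^ (-2 - β)) : |2 * r * q| ≤ 2 * K * r ^ (-β - 1) := by
  have h_rpow : r ^ (-β - 1) = r * r ^ (-2 - β) := by
    rw [← Real.rpow_one_add' hr.le (by linarith)]
    ring_nf
  calc |2 * r * q| = 2 * r * |q| := by rw [abs_mul, abs_of_pos (by positivity)]
    _ ≤ 2 * r * (K * r ^ (-2 - β)) := by gcongr
    _ = 2 * K * r ^ (-β - 1) := by rw [h_rpow]; ring

variable {M R r : ℝ} {S : Slice M R}

theorem hasDerivWithinAt_comp_pt_Ici {f : ℝ × ℝ → ℝ} (hr : R ≤ r)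
    (hf : DifferentiableWithinAt ℝ f S.future (S.pt r)) :
    HasDerivWithinAt (fun x => f (S.pt x)) (S.dr f (S.pt r) + 2 / D M r * S.dv f (S.pt r))
      (Ici R) r :=
  hasDerivWithinAt_comp_pt (Ici_subset_Ici.2 S.two_mul_lt_R.le) hf (S.hasDerivWithinAt_height hr)

theorem drad_eq_of_hasDerivWithinAt {f : ℝ × ℝ → ℝ} {f' : ℝ} (hr : R ≤ r)
    (hf : HasDerivWithinAt (fun x => f (S.pt x)) f' (Ici R) r) :
    S.drad f r = f (S.pt r) + r * f' :=
  (((hasDerivWithinAt_id r (Ici R)).mul hf).derivWithin (uniqueDiffOn_Ici R r hr)).trans (by simp)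

theorem drad_eq {f : ℝ × ℝ → ℝ} (hr : R ≤ r)
    (hf : DifferentiableWithinAt ℝ f S.future (S.pt r)) :
    S.drad f r = f (S.pt r) + r * (S.dr f (S.pt r) + 2 / D M r * S.dv f (S.pt r)) :=
  drad_eq_of_hasDerivWithinAt hr (hasDerivWithinAt_comp_pt_Ici hr hf)

theorem L_rmul_mul {f : ℝ × ℝ → ℝ} (hr : R ≤ r)
    (hf : DifferentiableWithinAt ℝ f S.future (S.pt r)) :
    S.L (rmul f) (S.pt r) * (2 / D M r) = S.drad f r := by
  have hr' : 2 * M < r := S.two_mul_lt_R.trans_le hr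
  have hp := S.pt_mem_future hr'.le
  have hD := S.D_pos hr'
  rw [L, dr_rmul hp hf, dv_rmul hp hf, drad_eq hr hf]
  simp only [pt]
  field_simp
  ring

namespace IsTimeIntegral

variable {φ φ₁ : ℝ × ℝ → ℝ}

theorem continuousOn_drad (h₁ : S.IsTimeIntegral φ φ₁) : ContinuousOn (S.drad φ) (Ici R) :=
  ((h₁.continuousOn_comp_pt.add (continuousOn_id.mul (h₁.continuousOn_dr_comp_pt.add
    ((continuousOn_two_div_D S.M_pos.le).mul h₁.continuousOn_dv_comp_pt)))).mono
      fun _ hr => S.two_mul_lt_R.trans_le hr).congr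
    fun _ hr => drad_eq hr (h₁.differentiableWithinAt (S.two_mul_lt_R.trans_le hr))

theorem hasDerivWithinAt_nullFlux (h₁ : S.IsTimeIntegral φ φ₁) (hr : R ≤ r) :
    HasDerivWithinAt (S.nullFlux φ φ₁) (2 * r * S.drad φ r) (Ici R) r := by
  have hr' : 2 * M < r := S.two_mul_lt_R.trans_le hr
  have hφ := h₁.differentiableWithinAt hr'
  have hD := S.D_pos hr'
  have hsq := ((hasDerivAt_pow 2 r).const_mul 2).hasDerivWithinAt (s := Ici R)
  refine ((h₁.hasDerivWithinAt_flux (Ici_subset_Ici.2 S.two_mul_lt_R.le) hr'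
    (S.hasDerivWithinAt_height hr)).add
      (hsq.mul (hasDerivWithinAt_comp_pt_Ici hr hφ))).congr_deriv ?_
  rw [drad_eq hr hφ]
  field_simp
  push_cast
  ring

theorem hasDerivWithinAt_comp_pt (h₁ : S.IsTimeIntegral φ φ₁) (hr : R ≤ r) :
    HasDerivWithinAt (fun x => φ₁ (S.pt x)) (S.nullFlux φ φ₁ r / (D M r * r ^ 2)) (Ici R) r := by
  have hr' : 2 * M < r := S.two_mul_lt_R.trans_le hr
  have hr0 : 0 < r := S.M_pos.trans (by linarith [S.M_pos])
  have hD := S.D_pos hr'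
  have hp := S.pt_mem_exterior hr'
  refine (hasDerivWithinAt_comp_pt_Ici hr
    (differentiableWithinAt_future (h₁.regular.of_le one_le_two) hp)).congr_deriv ?_
  rw [h₁.time_deriv _ hp.1 hp.2, nullFlux, flux]
  field_simp

theorem drad_eq (h₁ : S.IsTimeIntegral φ φ₁) (hr : R ≤ r) :
    S.drad φ₁ r = φ₁ (S.pt r) + S.nullFlux φ φ₁ r / (D M r * r) := by
  have hr0 : 0 < r := S.M_pos.trans (by linarith [S.M_pos, S.two_mul_lt_R])
  rw [drad_eq_of_hasDerivWithinAt hr (h₁.hasDerivWithinAt_comp_pt hr)]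
  field_simp

theorem hasDerivWithinAt_drad (h₁ : S.IsTimeIntegral φ φ₁) (hr : R ≤ r) :
    HasDerivWithinAt (S.drad φ₁)
      (2 * ((D M r)⁻¹ * S.drad φ r) - 2 * M * (D M r)⁻¹ ^ 2 * S.nullFlux φ φ₁ r / r ^ 3)
      (Ici R) r := by
  have hr' : 2 * M < r := S.two_mul_lt_R.trans_le hr
  have hr0 : r ≠ 0 := (S.M_pos.trans (by linarith [S.M_pos])).ne'
  have hD : D M r ≠ 0 := (S.D_pos hr').ne'
  have hquot := (h₁.hasDerivWithinAt_nullFlux hr).div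
    ((hasDerivAt_D (M := M) hr0).mul (hasDerivAt_id r)).hasDerivWithinAt (mul_ne_zero hD hr0)
  refine (((h₁.hasDerivWithinAt_comp_pt hr).add hquot).congr_of_mem
    (fun x hx => h₁.drad_eq hx) hr).congr_deriv ?_
  have hDr : 2 * M = r - D M r * r := by rw [D]; field_simp; ring
  simp only [Pi.mul_apply, id, hDr]
  field_simp
  ring

theorem drad2_eq (h₁ : S.IsTimeIntegral φ φ₁) (hr : R ≤ r) :
    S.drad2 φ₁ r =
      2 * ((D M r)⁻¹ * S.drad φ r) - 2 * M * (D M r)⁻¹ ^ 2 * S.nullFlux φ φ₁ r / r ^ 3 :=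
  (h₁.hasDerivWithinAt_drad hr).derivWithin (uniqueDiffOn_Ici R r hr)

theorem C₀_eq (h₁ : S.IsTimeIntegral φ φ₁) (hφ : ContDiffOn ℝ 1 φ S.future) :
    S.C₀ φ = S.nullFlux φ φ₁ R + ∫ r in Ioi R, 2 * r * S.drad φ r := by
  rw [C₀, nullFlux, h₁.flux_R hφ, ← integral_const_mul]
  congr 1
  refine setIntegral_congr_fun measurableSet_Ioi fun r hr => ?_
  have hr' : R ≤ r := le_of_lt hr
  rw [← L_rmul_mul hr' (h₁.differentiableWithinAt (S.two_mul_lt_R.trans hr))]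
  ring

variable {β Λ I J P K : ℝ}

theorem integrableOn_two_mul_drad (h₁ : S.IsTimeIntegral φ φ₁) (hR : 0 < R) (hβ : 0 < β)
    (hq : ∀ r, R ≤ r → |S.drad φ r| ≤ K * r ^ (-2 - β)) :
    IntegrableOn (fun r => 2 * r * S.drad φ r) (Ioi R) := by
  refine ((integrableOn_Ioi_rpow_of_lt (a := -β - 1) (by linarith) hR).const_mul (2 * K)).mono'
    (((continuousOn_const.mul continuousOn_id).mul h₁.continuousOn_drad).mono
      Ioi_subset_Ici_self |>.aestronglyMeasurable measurableSet_Ioi) ?_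
  filter_upwards [ae_restrict_mem measurableSet_Ioi] with r hr
  exact abs_two_mul_le_rpow hβ (hR.trans hr) (hq r (le_of_lt hr))

theorem tendsto_nullFlux (h₁ : S.IsTimeIntegral φ φ₁) (hφ : ContDiffOn ℝ 1 φ S.future)
    (hR : 0 < R) (hβ : 0 < β) (hq : ∀ r, R ≤ r → |S.drad φ r| ≤ K * r ^ (-2 - β)) :
    Tendsto (S.nullFlux φ φ₁) atTop (𝓝 (S.C₀ φ)) := by
  have hint := h₁.integrableOn_two_mul_drad hR hβ hq
  have hderiv : ∀ r ∈ Ioi R, HasDerivAt (S.nullFlux φ φ₁) (2 * r * S.drad φ r) r := fun r hr =>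
    (h₁.hasDerivWithinAt_nullFlux (le_of_lt hr)).hasDerivAt (Ici_mem_nhds hr)
  have hlim := tendsto_limUnder_of_hasDerivAt_of_integrableOn_Ioi hderiv hint
  rwa [h₁.C₀_eq hφ, integral_Ioi_of_hasDerivAt_of_tendsto
    (h₁.hasDerivWithinAt_nullFlux le_rfl).continuousWithinAt hderiv hint hlim, add_sub_cancel]

theorem abs_nullFlux_sub_C₀_le (h₁ : S.IsTimeIntegral φ φ₁) (hφ : ContDiffOn ℝ 1 φ S.future)
    (hR : 0 < R) (hβ : 0 < β) (hq : ∀ r, R ≤ r → |S.drad φ r| ≤ K * r ^ (-2 - β)) (hr : R ≤ r) :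
    |S.nullFlux φ φ₁ r - S.C₀ φ| ≤ 2 * K / β * r ^ (-β) :=
  norm_sub_le_rpow_of_norm_deriv_le hR hβ (fun _ hs => h₁.hasDerivWithinAt_nullFlux hs)
    (fun s hs => abs_two_mul_le_rpow hβ (hR.trans_le hs) (hq s hs))
    (h₁.tendsto_nullFlux hφ hR hβ hq) hr

theorem tendsto_drad (h₁ : S.IsTimeIntegral φ φ₁) (hφ : ContDiffOn ℝ 1 φ S.future)
    (hR : 0 < R) (hβ : 0 < β) (hq : ∀ r, R ≤ r → |S.drad φ r| ≤ K * r ^ (-2 - β)) :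
    Tendsto (S.drad φ₁) atTop (𝓝 0) := by
  have hDr : Tendsto (fun r => D M r * r) atTop atTop := by
    refine (tendsto_atTop_add_const_right atTop (-(2 * M)) tendsto_id).congr' ?_
    filter_upwards [eventually_ne_atTop 0] with r hr
    simp only [D, id]
    field_simp
    ring
  have hsum := h₁.lim_infinity.add ((h₁.tendsto_nullFlux hφ hR hβ hq).div_atTop hDr)
  rw [add_zero] at hsum
  refine hsum.congr' ?_
  filter_upwards [eventually_ge_atTop R] with r hr using (h₁.drad_eq hr).symm

theorem abs_drad2_expansion_le (h₁ : S.IsTimeIntegral φ φ₁) (hφ : ContDiffOn ℝ 1 φ S.future)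
    (hR : 0 < R) (hβ : 0 < β) (hΛ : ∀ r, R ≤ r → |Real.log r| + 1 ≤ Λ * r ^ (1 - β))
    (hq : ∀ r, R ≤ r →
      |S.drad φ r - I * (Real.log r / r ^ 3) - J / r ^ 3| ≤ P * r ^ (-3 - β)) (hr : R ≤ r) :
    |S.drad2 φ₁ r - 2 * I * (Real.log r / r ^ 3) - 2 * (J - M * S.C₀ φ) / r ^ 3| ≤
      (4 + 2 * R * Λ + 4 * (1 + R * Λ) / β + 2 * R ^ 2 * Λ) * (P + |I| + |J| + |S.C₀ φ|) *
        r ^ (-3 - β) := by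
  have hr0 := hR.trans_le hr
  have hflux := h₁.abs_nullFlux_sub_C₀_le hφ hR hβ
    (fun s hs => abs_le_rpow_of_log_expansion hR hs (hΛ s hs) (hq s hs)) hr
  have hsource := abs_inv_D_mul_sub_le S.M_pos.le S.lt_R hr (hΛ r hr) (hq r hr)
  have hmass := abs_inv_D_sq_mul_sub_le S.M_pos.le S.lt_R hr (hΛ r hr) hflux
  have hΛ0 : 0 ≤ Λ := nonneg_of_mul_nonneg_left (le_trans (by positivity) (hΛ r hr))
    (Real.rpow_pos_of_pos hr0 _)
  have hP : 0 ≤ P := nonneg_of_mul_nonneg_left ((abs_nonneg _).trans (hq r hr))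
    (Real.rpow_pos_of_pos hr0 _)
  rw [h₁.drad2_eq hr]
  rw [rpow_neg_ofNat_sub hr0] at hsource ⊢
  have hX : 0 < r ^ (-β) := Real.rpow_pos_of_pos hr0 _
  set X := r ^ (-β)
  set Q := P + |I| + |J|
  set N := Q + |S.C₀ φ|
  calc |2 * ((D M r)⁻¹ * S.drad φ r) - 2 * M * (D M r)⁻¹ ^ 2 * S.nullFlux φ φ₁ r / r ^ 3 -
          2 * I * (Real.log r / r ^ 3) - 2 * (J - M * S.C₀ φ) / r ^ 3|
      = |2 * ((D M r)⁻¹ * S.drad φ r - I * (Real.log r / r ^ 3) - J / r ^ 3) -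
          (2 * M * (D M r)⁻¹ ^ 2 * S.nullFlux φ φ₁ r - 2 * M * S.C₀ φ) / r ^ 3| := by
        congr 1; ring
    _ ≤ 2 * ((2 * P + R * Λ * (|I| + |J|)) * (X / r ^ 3)) +
          (2 * R * (2 * ((R⁻¹ + Λ) * Q) / β) + 2 * R ^ 2 * Λ * |S.C₀ φ|) * X / r ^ 3 := by
        refine (abs_sub _ _).trans (add_le_add ?_ ?_)
        · rw [abs_mul, abs_two]
          gcongr
        · rw [abs_div, abs_of_pos (pow_pos hr0 3)]
          gcongr
    _ = (4 * P + 2 * R * Λ * (|I| + |J|) + 4 * (1 + R * Λ) / β * Q + 2 * R ^ 2 * Λ * |S.C₀ φ|) *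
          (X / r ^ 3) := by field_simp; ring
    _ ≤ (4 * N + 2 * R * Λ * N + 4 * (1 + R * Λ) / β * N + 2 * R ^ 2 * Λ * N) *
          (X / r ^ 3) := by gcongr <;> grind
    _ = _ := by ring

theorem abs_drad_expansion_le (h₁ : S.IsTimeIntegral φ φ₁) (hφ : ContDiffOn ℝ 1 φ S.future)
    (hR : 0 < R) (hβ : 0 < β) (hq : ∀ r, R ≤ r → |S.drad φ r| ≤ K * r ^ (-2 - β)) {A K' : ℝ}
    (hdrad2 : ∀ r, R ≤ r →
      |S.drad2 φ₁ r - 2 * I * (Real.log r / r ^ 3) - 2 * A / r ^ 3| ≤ K' * r ^ (-3 - β))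
    (hr : R ≤ r) :
    |S.drad φ₁ r + I * (Real.log r / r ^ 2) + (A + 1 / 2 * I) / r ^ 2| ≤ K' * r ^ (-2 - β) :=
  abs_log_expansion_le_of_deriv hR hβ
    (fun _ hs => (h₁.hasDerivWithinAt_drad hs).differentiableWithinAt.hasDerivWithinAt)
    hdrad2 (h₁.tendsto_drad hφ hR hβ hq) hr

end IsTimeIntegral

end Infinity

section Constants

variable {M R : ℝ} {S : Slice M R} {f : ℝ × ℝ → ℝ} {I A : ℝ}

theorem isNPConstant_of_tendsto
    (hlim : Tendsto (fun r => r ^ 2 * S.drad f r + I * Real.log r) atTop (𝓝 A)) :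
    S.IsNPConstant (fun r => r ^ 2 / Real.log r) f (-I) := by
  have hdiv := (hlim.div_atTop Real.tendsto_log_atTop).sub_const I
  rw [zero_sub] at hdiv
  refine hdiv.congr' ?_
  filter_upwards [eventually_gt_atTop 1] with r hr
  have hlog := Real.log_pos hr
  field_simp
  ring

theorem isPrimedConstant_of_tendsto
    (hlim : Tendsto (fun r => r ^ 2 * S.drad f r + I * Real.log r) atTop (𝓝 A)) (s : ℝ) :
    S.IsPrimedConstant f (-I) s (A + I * s) := by
  refine (hlim.add_const (I * s)).congr' ?_
  filter_upwards [eventually_gt_atTop 0] with r hr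
  field_simp
  ring

end Constants

end Slice

end Schwarzschild

theorem proposition5p3_general (R β : ℝ) (hR : 0 < R) (hβ0 : 0 < β) (hβ1 : β < 1) :
    ∃ C : ℝ, 0 < C ∧ ∀ (M : ℝ) (S : Schwarzschild.Slice M R) (φ φ₁ : ℝ × ℝ → ℝ) (I J P : ℝ),
      ContDiffOn ℝ 1 φ S.future →
      (∀ r, R ≤ r →
        |S.drad φ r - I * (Real.log r / r ^ 3) - J / r ^ 3| ≤ P * r ^ (-3 - β)) →
      S.IsTimeIntegral φ φ₁ →
      (∀ r, R ≤ r →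
        |S.drad φ₁ r + I * (Real.log r / r ^ 2) + (J + 1 / 2 * I - M * S.C₀ φ) / r ^ 2| ≤
          C * (P + |I| + |J| + |S.C₀ φ|) * r ^ (-2 - β)) ∧
      (∀ r, R ≤ r →
        |S.drad2 φ₁ r - 2 * I * (Real.log r / r ^ 3) - (2 * J - 2 * M * S.C₀ φ) / r ^ 3| ≤
          C * (P + |I| + |J| + |S.C₀ φ|) * r ^ (-3 - β)) ∧
      ∃ Ilog I' I'' : ℝ,
        S.IsNPConstant (fun r => r ^ 2 / Real.log r) φ₁ Ilog ∧
        S.IsPrimedConstant φ₁ Ilog (Real.log 2) I' ∧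
        S.IsPrimedConstant φ₁ Ilog (-Real.log 2) I'' ∧
        Ilog = -I ∧
        I' + Real.log 2 * Ilog = M * S.C₀ φ - J - 1 / 2 * I ∧
        I'' - Real.log 2 * Ilog = M * S.C₀ φ - J - 1 / 2 * I := by
  obtain ⟨Λ, hΛ0, hΛ⟩ := Schwarzschild.exists_abs_log_add_one_le_rpow hR (sub_pos.2 hβ1)
  refine ⟨4 + 2 * R * Λ + 4 * (1 + R * Λ) / β + 2 * R ^ 2 * Λ, by positivity,
    fun M S φ φ₁ I J P hφ hq h₁ => ?_⟩
  have hdrad2 := fun r hr => h₁.abs_drad2_expansion_le hφ hR hβ0 hΛ hq (r := r) hr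
  have hdrad := fun r hr => h₁.abs_drad_expansion_le hφ hR hβ0
    (fun s hs => Schwarzschild.abs_le_rpow_of_log_expansion hR hs (hΛ s hs) (hq s hs))
    hdrad2 (r := r) hr
  have hlim := Schwarzschild.tendsto_of_log_expansion hβ0 hdrad
  refine ⟨fun r hr => ?_, fun r hr => ?_, -I, _, _,
    Schwarzschild.Slice.isNPConstant_of_tendsto hlim,
    Schwarzschild.Slice.isPrimedConstant_of_tendsto hlim _,
    Schwarzschild.Slice.isPrimedConstant_of_tendsto hlim _, rfl, by ring, by ring⟩
  · rw [add_sub_right_comm]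
    exact hdrad r hr
  · rw [mul_assoc 2 M, ← mul_sub]
    exact hdrad2 r hr

theorem proposition5p3 (R β : ℝ) (hR : 0 < R) (hβ0 : 0 < β) (hβ1 : β < 1) :
    ∃ C : ℝ, 0 < C ∧ ∀ M : ℝ, 0 < M → ∀ (S : Schwarzschild.Slice M R) (φ φ₁ : ℝ × ℝ → ℝ)
      (I J P : ℝ),
      S.IsSmoothSolution φ →
      S.IsNPConstant (fun r => r ^ 3 / Real.log r) φ I →
      (∀ r, R ≤ r →
        |S.drad φ r - I * (Real.log r / r ^ 3) - J / r ^ 3| ≤ P * r ^ (-3 - β)) →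
      S.IsTimeIntegral φ φ₁ →
      (∀ r, R ≤ r →
        |S.drad φ₁ r + I * (Real.log r / r ^ 2) + (J + 1 / 2 * I - M * S.C₀ φ) / r ^ 2| ≤
          C * (P + |I| + |J| + |S.C₀ φ|) * r ^ (-2 - β)) ∧
      (∀ r, R ≤ r →
        |S.drad2 φ₁ r - 2 * I * (Real.log r / r ^ 3) - (2 * J - 2 * M * S.C₀ φ) / r ^ 3| ≤
          C * (P + |I| + |J| + |S.C₀ φ|) * r ^ (-3 - β)) ∧
      ∃ Ilog I' I'' : ℝ,
        S.IsNPConstant (fun r => r ^ 2 / Real.log r) φ₁ Ilog ∧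
        S.IsPrimedConstant φ₁ Ilog (Real.log 2) I' ∧
        S.IsPrimedConstant φ₁ Ilog (-Real.log 2) I'' ∧
        Ilog = -I ∧
        I' + Real.log 2 * Ilog = M * S.C₀ φ - J - 1 / 2 * I ∧
        I'' - Real.log 2 * Ilog = M * S.C₀ φ - J - 1 / 2 * I := by
  obtain ⟨C, hC, h⟩ := proposition5p3_general R β hR hβ0 hβ1
  exact ⟨C, hC, fun M _ S φ φ₁ I J P hφ _ hq h₁ =>
    h M S φ φ₁ I J P (hφ.smooth.of_le (by simp)) hq h₁⟩
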